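/- Let $\mathbb K\neq 0$ be a commutative Hausdorff topological ring in which $2$ is invertible, such that the group of units $\mathbb K^\times$ is open and dense in $\mathbb K$ and inversion is continuous on $\mathbb K^\times$ (for instance $\mathbb K=\mathbb R$, $\mathbb C$ or $\mathbb Q_p$). Let $n\ge 1$. Smoothness is understood in the sense of the differential calculus over topological rings: $f$ is of class $C^1$ if the difference quotient $\frac{f(x+tv)-f(x)}{t}$ extends continuously to $t=0$, and so on inductively; over $\mathbb R$ this is the usual notion. A *symmetric space* is a manifold $M$ with a smooth product $\mu(x,y)=\sigma_x(y)$ such that $\sigma_x(x)=x$, $\sigma_x^2=\mathrm{id}$, $\sigma_x$ is an automorphism of $\mu$, and $T_x\sigma_x=-\mathrm{id}$. A *symmetric bundle* over $M$ is a vector bundle $\pi:F\to M$ with a symmetric space structure $\mu$ on $F$ such that $\pi$ is a homomorphism and all maps $F_p\oplus F_q\to F_{\mu(p,q)}$, $(v,w)\mapsto\mu(v,w)$, are linear; an isomorphism of symmetric bundles is an isomorphism of vector bundles (possibly over a non-trivial automorphism of the base) that is an isomorphism of symmetric spaces. Its *underlying reflection space* is $F$ with the product $\nu_u=\sigma_{u/2}\,\sigma_{0_p}\,(-1)_F\,\sigma_{u/2}$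 for $u\in F_p$. The tangent space of a symmetric space at a base point $o$ carries its Lie triple bracket $[u,v,w]=[[\tilde u,\tilde v],\tilde w](o)$, where $\tilde u(p)=\sigma_{u/2}\sigma_{0_o}(0_p)$, computed in $TM$. For a symmetric bundle one has $T_{0_o}F=T_oM\oplus V$ with $V=F_o$, and its *Lts representation* on $V$ is given by $r(X,Y)w=[X,Y,w]$ and $m(X,Z)v=[X,v,Z]$ $(X,Y,Z\in T_oM)$. The *adjoint* representation of the Lie triple system $T_oM$ on itself is given by $r(X,Y)w=[X,Y,w]$, $m(X,Z)v=[X,v,Z]$. Two representations of the same Lie triple system are *equivalent* if a linear bijection intertwines both $r$ and $m$. Let $\mathbb K[\varepsilon]$, $\varepsilon^2=0$, be the dual numbers with conjugation $\overline{a+\varepsilon b}=a-\varepsilon b$, and let $$\mathrm D=\Big\{\begin{pmatrix}a&b\\ \bar b&\bar a\end{pmatrix}\ \Big|\ a,b\in\mathbb K[\varepsilon]\Big\}$$ be the ring of degenerate quaternions, with involution $X\mapsto IXI$, $I=\mathrm{diag}(1,-1)$, whose fixed ring is the ring of diagonal matrices $\mathrm{diag}(a,\bar a)\cong\mathbb K[\varepsilon]$.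 Let $\sigma$ be the induced involution of the Lie group $L=\mathrm{Gl}(n,\mathrm D)$. **Theorem.** Consider $\mathrm{Gl}(n,\mathbb K)$ as a symmetric space with $\mu(g,h)=gh^{-1}g$, and take the identity matrix as base point. 1. (The usual structure.) $T\,\mathrm{Gl}(n,\mathbb K)$ with the product $T\mu$ is a symmetric bundle over $\mathrm{Gl}(n,\mathbb K)$. The map $(g,X)\mapsto g+\varepsilon X$ is an isomorphism of symmetric spaces onto $\mathrm{Gl}(n,\mathbb K[\varepsilon])$ with product $ab^{-1}a$. The Lts representation of this bundle is the adjoint one. 2. (The second structure.) The fixed point group of $\sigma$ is $\mathrm{Gl}(n,\mathbb K[\varepsilon])$, embedded through the diagonal matrices of $\mathrm D$. There is a product $\mu'$ on $T\,\mathrm{Gl}(n,\mathbb K)$ that makes the same vector bundle a symmetric bundle over the same symmetric space $\mathrm{Gl}(n,\mathbb K)$, and an isomorphism of symmetric spaces $$\Phi:\ \mathrm{Gl}(n,\mathrm D)/\mathrm{Gl}(n,\mathbb K[\varepsilon])\ \longrightarrow\ (T\,\mathrm{Gl}(n,\mathbb K),\mu'),$$ where the homogeneous space $L/H$ carries the product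 $\mu(gH,g'H)=g\,\sigma(g)^{-1}\sigma(g')H$ and the manifold structure for which $L\to L/H$ is a submersion, such that moreover: * the underlying homogeneous bundle is the usual one: $\Phi$ sends the base point to $0_{\mathbf 1}$, and it is equivariant for $\mathrm{Gl}(n,\mathbb K)\times\mathrm{Gl}(n,\mathbb K)$, where $(g,h)$ acts on $L/H$ through the element $\frac12\begin{pmatrix}g+h&h-g\\ h-g&g+h\end{pmatrix}$ of $\mathrm{Gl}(n,\mathrm D)$, and on $T\,\mathrm{Gl}(n,\mathbb K)$ by $(p,X)\mapsto(gph^{-1},gXh^{-1})$; * the underlying reflection spaces of $\mu'$ and of $T\mu$ coincide; * the Lts representation of $\mu'$ is a representation of the Lie triple system of $\mathrm{Gl}(n,\mathbb K)$ whose $r$-component is that of the adjoint representation, but it is not equivalent to the adjoint representation; * the symmetric bundles $(T\,\mathrm{Gl}(n,\mathbb K),T\mu)$ and $(T\,\mathrm{Gl}(n,\mathbb K),\mu')$ are not isomorphic. -/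

import Mathlib

universe u

namespace SymBundle

/-! ## Differential calculus over a topological ring

A function `f` on an open set `U` is of class `C¹` if its difference quotient, defined for
invertible `t`, extends continuously to all `(x, v, t)` with `x ∈ U` and `x + t v ∈ U`
(Bertram, Glöckner and Neeb). Over `ℝ` and in finite dimension this is the usual notion. -/

section Calculus

variable (K : Type u) [CommRing K] [TopologicalSpace K]

/-- The domain of the extended difference quotient of a function on `U`. -/
def quotientDomain {E : Type u} [AddCommGroup E] [Module K E] (U : Set E) : Set (E × E × K) :=
  {z | z.1 ∈ U ∧ z.1 + z.2.2 • z.2.1 ∈ U}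

/-- `g` is a continuous extension of the difference quotient of `f` on `U`. -/
structure IsDifferenceQuotient {E F : Type u} [AddCommGroup E] [Module K E] [TopologicalSpace E]
    [AddCommGroup F] [Module K F] [TopologicalSpace F]
    (U : Set E) (f : E → F) (g : E × E × K → F) : Prop where
  continuousOn : ContinuousOn g (quotientDomain K U)
  eq : ∀ (x v : E) (t : K), (x, v, t) ∈ quotientDomain K U →
    f (x + t • v) - f x = t • g (x, v, t)

/-- `f` is of class `C^k` on `U`. -/
def CkOn : (k : ℕ) → {E F : Type u} → [AddCommGroup E] → [Module K E] → [TopologicalSpace E] →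
    [AddCommGroup F] → [Module K F] → [TopologicalSpace F] → (U : Set E) → (f : E → F) → Prop
  | 0, _, _, _, _, _, _, _, _, U, f => ContinuousOn f U
  | k + 1, _, _, _, _, _, _, _, _, U, f =>
      ∃ g, IsDifferenceQuotient K U f g ∧ CkOn k (quotientDomain K U) g

variable {E F : Type u} [AddCommGroup E] [Module K E] [TopologicalSpace E]
  [AddCommGroup F] [Module K F] [TopologicalSpace F]

/-- `f` is smooth on `U`. -/
def SmoothOn (U : Set E) (f : E → F) : Prop := ∀ k : ℕ, CkOn K k U f

open Classical in
/-- The differential `df(x) v`, the value of the extended difference quotient at `t = 0`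
(and `0` if `f` is not of class `C¹`). The extension is unique on an open `U` when `F` is
Hausdorff and the units of `K` are dense. -/
noncomputable def differential (U : Set E) (f : E → F) (x v : E) : F :=
  if h : ∃ g, IsDifferenceQuotient K U f g then h.choose (x, v, 0) else 0

end Calculus

/-! ## Manifolds with a global chart

A manifold is given here by a set `M` and one chart `φ : M → E` onto an open subset of a
topological `K`-module `E`; so every tangent space is identified with `E`. -/

section Manifolds

variable (K : Type u) [CommRing K] [TopologicalSpace K]
  {E : Type u} [AddCommGroup E] [Module K E] [TopologicalSpace E]
  {E' : Type u} [AddCommGroup E'] [Module K E'] [TopologicalSpace E']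
  {M N : Type u}

/-- `φ` is a bijection of `M` with an open set. -/
def IsGlobalChart {E : Type u} [TopologicalSpace E] {M : Type u} (φ : M → E) : Prop :=
  Function.Injective φ ∧ IsOpen (Set.range φ)

/-- The expression `ψ ∘ f ∘ φ⁻¹` of `f` in the charts `φ` and `ψ` (with value `0` outside the
image of `φ`). -/
noncomputable def inCharts {E E' : Type u} [AddCommGroup E'] {M N : Type u}
    (φ : M → E) (ψ : N → E') (f : M → N) : E → E' :=
  Function.extend φ (ψ ∘ f) 0

/-- `f : M → N` is smooth. -/
def SmoothMap (φ : M → E) (ψ : N → E') (f : M → N) : Prop :=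
  SmoothOn K (Set.range φ) (inCharts φ ψ f)

/-- The tangent map `T_p f : E → E'`. -/
noncomputable def tangentMap (φ : M → E) (ψ : N → E') (f : M → N) (p : M) (v : E) : E' :=
  differential K (Set.range φ) (inCharts φ ψ f) (φ p) v

/-- `f` is a smooth submersion: through every point of `M` there passes a smooth local section
of `f` that is defined on an open subset of `N`. -/
structure IsSubmersion (φ : M → E) (ψ : N → E') (f : M → N) : Prop where
  smooth : SmoothMap K φ ψ f
  localSection : ∀ p : M, ∃ V : Set E', IsOpen V ∧ ψ (f p) ∈ V ∧ ∃ s : N → M, s (f p) = p ∧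
    (∀ q, ψ q ∈ V → f (s q) = q) ∧ SmoothOn K (V ∩ Set.range ψ) (inCharts ψ φ s)

/-- The Lie bracket of two vector fields (up to a sign convention, which does not affect
triple brackets). -/
noncomputable def fieldBracket (φ : M → E) (X Y : M → E) (p : M) : E :=
  tangentMap K φ (id : E → E) X p (Y p) - tangentMap K φ (id : E → E) Y p (X p)

end Manifolds

/-! ## Symmetric spaces -/

section SymmetricSpaces

variable (K : Type u) [CommRing K] [TopologicalSpace K]
  {E : Type u} [AddCommGroup E] [Module K E] [TopologicalSpace E]
  {E' : Type u} [AddCommGroup E'] [Module K E'] [TopologicalSpace E']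
  {M N : Type u}

/-- `(M, μ)` is a symmetric space, with symmetries `σ_x = μ x`. -/
structure IsSymmetricSpace (φ : M → E) (μ : M → M → M) : Prop where
  chart : IsGlobalChart φ
  smooth : SmoothMap K (Prod.map φ φ) φ (Function.uncurry μ)
  idem : ∀ x, μ x x = x
  invol : ∀ x y, μ x (μ x y) = y
  distrib : ∀ x y z, μ x (μ y z) = μ (μ x y) (μ x z)
  differential : ∀ (x : M) (v : E), tangentMap K φ φ (μ x) x v = -v

/-- Isomorphisms of symmetric spaces. -/
structure IsSymmetricSpaceIso (φ : M → E) (ψ : N → E') (μ : M → M → M) (ν : N → N → N)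
    (e : M ≃ N) : Prop where
  smooth : SmoothMap K φ ψ e
  smooth_symm : SmoothMap K ψ φ e.symm
  map_mul : ∀ x y, e (μ x y) = ν (e x) (e y)

/-- The symmetric space product `μ(g, h) = g h⁻¹ g` of a group. -/
def groupProduct {G : Type u} [Group G] (g h : G) : G := g * h⁻¹ * g

/-- The product `Tμ` on the tangent bundle `TM = M × E`. -/
noncomputable def tangentProduct (φ : M → E) (μ : M → M → M) (a b : M × E) : M × E :=
  (μ a.1 b.1, tangentMap K (Prod.map φ φ) φ (Function.uncurry μ) (a.1, b.1) (a.2, b.2))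

/-- The vector field `p ↦ σ_{v/2} σ_{0_o} (0_p)`, with the symmetries of `TM`. It is the unique
derivation with value `v` at `o` in the `-1`-eigenspace for the symmetry at `o`. -/
noncomputable def transvectionField [Invertible (2 : K)] (φ : M → E) (μ : M → M → M) (o : M)
    (v : E) (p : M) : E :=
  (tangentProduct K φ μ (o, ⅟(2 : K) • v) (tangentProduct K φ μ (o, 0) (p, 0))).2

/-- The Lie triple bracket `[u, v, w] = [[u, v], w]` on the tangent space at the base point `o`. -/
noncomputable def ltsBracket [Invertible (2 : K)] (φ : M → E) (μ : M → M → M) (o : M)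
    (u v w : E) : E :=
  fieldBracket K φ
    (fieldBracket K φ (transvectionField K φ μ o u) (transvectionField K φ μ o v))
    (transvectionField K φ μ o w) o

end SymmetricSpaces

/-! ## Lie triple systems and their modules -/

section LieTripleSystems

variable (K : Type u) [CommRing K] {E W W' : Type u} [AddCommGroup E] [Module K E]
  [AddCommGroup W] [Module K W] [AddCommGroup W'] [Module K W']

/-- The bracket `B` makes `E` a Lie triple system. -/
structure IsLieTripleSystem (B : E → E → E → E) : Prop where
  trilinear : ∃ T : E →ₗ[K] E →ₗ[K] E →ₗ[K] E, ∀ x y z, T x y z = B x y z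
  skew : ∀ x y z, B x y z = -B y x z
  jacobi : ∀ x y z, B x y z + B y z x + B z x y = 0
  derivation : ∀ x y a b c,
    B x y (B a b c) = B (B x y a) b c + B a (B x y b) c + B a b (B x y c)

/-- `(r, m)` is a general representation of the Lie triple system `(E, B)` on `W`; the operators
`r(x, y)` and `m(x, y)` of `W` are written `r x y` and `m x y`. -/
structure IsLtsModule (B : E → E → E → E) (r m : E → E → W → W) : Prop where
  r_linear : ∃ T : E →ₗ[K] E →ₗ[K] Module.End K W, ∀ x y w, T x y w = r x y w
  m_linear : ∃ T : E →ₗ[K] E →ₗ[K] Module.End K W, ∀ x y w, T x y w = m x y w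
  r_skew : ∀ x y w, r x y w = -r y x w
  m_sub : ∀ x z w, m x z w - m z x w = r x z w
  r_deriv : ∀ x y a b w,
    r (B x y a) b w + r a (B x y b) w = r x y (r a b w) - r a b (r x y w)
  m_deriv : ∀ x y a b w,
    m (B x y a) b w + m a (B x y b) w = r x y (m a b w) - m a b (r x y w)
  m_bracket : ∀ x a b c w,
    m x (B a b c) w - r a b (m x c w) = m a c (m x b w) - m b c (m x a w)

/-- The two modules given by `(r, m)` and `(r', m')` are isomorphic. -/
def LtsModuleEquivalent (r m : E → E → W → W) (r' m' : E → E → W' → W') : Prop :=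
  ∃ A : W ≃ₗ[K] W', (∀ x y w, A (r x y w) = r' x y (A w)) ∧
    ∀ x y w, A (m x y w) = m' x y (A w)

/-- The `r`-component `r(x, y) w = [x, y, w]` of the adjoint (regular) representation. -/
def adjointR (B : E → E → E → E) (x y w : E) : E := B x y w

/-- The `m`-component `m(x, z) w = [x, w, z]` of the adjoint (regular) representation. -/
def adjointM (B : E → E → E → E) (x z w : E) : E := B x w z

end LieTripleSystems

/-! ## Symmetric bundles

The total space is `M × W`, with projection `Prod.fst`, so that all fibers are identified
with `W`; its chart is `Prod.map φ id`. The tangent bundle of `M` is the case `W = E`. -/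

section SymmetricBundles

variable (K : Type u) [CommRing K] [TopologicalSpace K]
  {E : Type u} [AddCommGroup E] [Module K E] [TopologicalSpace E]
  {W : Type u} [AddCommGroup W] [Module K W] [TopologicalSpace W]
  {M : Type u}

/-- The chart of the total space `M × W`. -/
def bundleChart {E W M : Type u} (φ : M → E) : M × W → E × W := Prod.map φ id

/-- The product `μ` on `M × W` makes it a symmetric bundle over the symmetric space `(M, μM)`. -/
structure IsSymmetricBundle (φ : M → E) (μM : M → M → M) (μ : M × W → M × W → M × W) : Prop where
  base : IsSymmetricSpace K φ μM
  total : IsSymmetricSpace K (bundleChart (W := W) φ) μ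
  proj : ∀ a b, (μ a b).1 = μM a.1 b.1
  fiber_linear : ∀ p q : M, ∃ A : W × W →ₗ[K] W, ∀ v w : W, (μ (p, v) (q, w)).2 = A (v, w)

/-- `e` is an isomorphism of symmetric bundles from `(M × W, μ)` to `(M × W, μ')`. It may cover
any isomorphism `f` of the base. -/
structure IsSymmetricBundleIso (φ : M → E) (μM : M → M → M) (μ μ' : M × W → M × W → M × W)
    (f : M ≃ M) (e : M × W ≃ M × W) : Prop where
  base : IsSymmetricSpaceIso K φ φ μM μM f
  total : IsSymmetricSpaceIso K (bundleChart (W := W) φ) (bundleChart (W := W) φ) μ μ' e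
  proj : ∀ a, (e a).1 = f a.1
  fiber_linear : ∀ p : M, ∃ A : W →ₗ[K] W, ∀ w : W, (e (p, w)).2 = A w

/-- The `r`-component `r(x, y) w = [x, y, w]` of the Lie triple representation of a symmetric
bundle: it lives on the fiber over `o`, and the tangent space at the zero vector `0_o` is the
sum `E ⊕ W` of the tangent spaces of the zero section and of the fiber. -/
noncomputable def bundleR [Invertible (2 : K)] (φ : M → E) (μ : M × W → M × W → M × W) (o : M)
    (x y : E) (w : W) : W :=
  (ltsBracket K (bundleChart (W := W) φ) μ (o, 0) (x, 0) (y, 0) (0, w)).2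

/-- The `m`-component `m(x, z) w = [x, w, z]` of the representation of a symmetric bundle. -/
noncomputable def bundleM [Invertible (2 : K)] (φ : M → E) (μ : M × W → M × W → M × W) (o : M)
    (x z : E) (w : W) : W :=
  (ltsBracket K (bundleChart (W := W) φ) μ (o, 0) (x, 0) (0, w) (z, 0)).2

/-- The vertical symmetry `ν_u = σ_{u/2} σ_{0_p} (-1) σ_{u/2}` for `u` in the fiber over `p`: the
product of the reflection space that underlies a symmetric bundle. -/
def verticalSymmetry [Invertible (2 : K)] (μ : M × W → M × W → M × W) (u a : M × W) : M × W :=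
  let h : M × W := (u.1, ⅟(2 : K) • u.2)
  let b : M × W := μ h a
  μ h (μ (u.1, 0) (b.1, -b.2))

end SymmetricBundles

/-! ## Homogeneous symmetric spaces -/

section Homogeneous

variable (K : Type u) [CommRing K] [TopologicalSpace K]
  {E : Type u} [AddCommGroup E] [Module K E] [TopologicalSpace E]
  {E' : Type u} [AddCommGroup E'] [Module K E'] [TopologicalSpace E']
  {L N : Type u} [Group L]

/-- `L` is a Lie group (with a global chart), `σ` is an involution of `L`, and `H` is the group
of its fixed points. -/
structure IsSymmetricPair (φ : L → E) (σ : L →* L) (H : Subgroup L) : Prop where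
  chart : IsGlobalChart φ
  smooth_mul : SmoothMap K (Prod.map φ φ) φ (fun a : L × L => a.1 * a.2)
  smooth_inv : SmoothMap K φ φ (fun g : L => g⁻¹)
  smooth_invol : SmoothMap K φ φ σ
  invol : ∀ g, σ (σ g) = g
  mem_iff : ∀ g, g ∈ H ↔ σ g = g

/-- `Φ` is an isomorphism of symmetric spaces from `L/H` to `(N, μ)`. The product on `L/H` is
`μ(gH, g'H) = g σ(g)⁻¹ σ(g') H`, and its manifold structure is the one for which the projection
from `L` is a submersion. -/
structure IsHomogeneousRealization (φ : L → E) (σ : L →* L) (H : Subgroup L) (ψ : N → E')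
    (μ : N → N → N) (Φ : L ⧸ H ≃ N) : Prop where
  submersion : IsSubmersion K φ ψ (fun g : L => Φ (g : L ⧸ H))
  map_mul : ∀ g g' : L,
    Φ ((g * (σ g)⁻¹ * σ g' : L) : L ⧸ H) = μ (Φ (g : L ⧸ H)) (Φ (g' : L ⧸ H))

end Homogeneous

/-! ## Degenerate quaternions -/

section DegenerateQuaternions

variable (K : Type u) [CommRing K]

/-- The conjugation `x + ε y ↦ x - ε y` of the dual numbers. -/
noncomputable def dualConj : DualNumber K →ₐ[K] DualNumber K :=
  TrivSqZeroExt.map (-LinearMap.id : K →ₗ[K] K)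

theorem dualConj_dualConj (a : DualNumber K) : dualConj K (dualConj K a) = a := by
  ext <;> simp [dualConj]

/-- The matrix with rows `(a, b)` and `(conj b, conj a)`. -/
noncomputable def quatMatrix (a b : DualNumber K) : Matrix (Fin 2) (Fin 2) (DualNumber K) :=
  !![a, b; dualConj K b, dualConj K a]

/-- The ring of degenerate quaternions over `K`. -/
noncomputable def DegenerateQuaternion :
    Subalgebra K (Matrix (Fin 2) (Fin 2) (DualNumber K)) where
  carrier := {X | ∃ a b, X = quatMatrix K a b}
  mul_mem' := by
    rintro _ _ ⟨a, b, rfl⟩ ⟨c, d, rfl⟩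
    refine ⟨a * c + b * dualConj K d, a * d + b * dualConj K c, ?_⟩
    simp only [quatMatrix, Matrix.mul_fin_two, map_add, map_mul, dualConj_dualConj]
    congr! 3
    all_goals ring_nf
  add_mem' := by
    rintro _ _ ⟨a, b, rfl⟩ ⟨c, d, rfl⟩
    refine ⟨a + c, b + d, Matrix.ext fun i j => ?_⟩
    fin_cases i <;> fin_cases j <;> simp [quatMatrix]
  algebraMap_mem' := by
    intro k
    refine ⟨algebraMap K _ k, 0, Matrix.ext fun i j => ?_⟩
    fin_cases i <;> fin_cases j <;> simp [quatMatrix, Matrix.algebraMap_matrix_apply]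

/-- The embedding of the dual numbers as the subalgebra of diagonal matrices. -/
noncomputable def diagEmbedding : DualNumber K →ₐ[K] DegenerateQuaternion K :=
  AlgHom.codRestrict
    { toFun := fun a => quatMatrix K a 0
      map_one' := by simp [quatMatrix, Matrix.one_fin_two]
      map_mul' := by intro a b; simp [quatMatrix]
      map_zero' := by
        refine Matrix.ext fun i j => ?_
        fin_cases i <;> fin_cases j <;> simp [quatMatrix]
      map_add' := by
        intro a b
        refine Matrix.ext fun i j => ?_
        fin_cases i <;> fin_cases j <;> simp [quatMatrix]
      commutes' := by
        intro k
        refine Matrix.ext fun i j => ?_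
        fin_cases i <;> fin_cases j <;> simp [quatMatrix, Matrix.algebraMap_matrix_apply] }
    (DegenerateQuaternion K) (fun a => ⟨a, 0, rfl⟩)

/-- The conjugation `X ↦ I X I`, where `I = diag(1, -1)`. -/
noncomputable def quatInvolution : DegenerateQuaternion K →ₐ[K] DegenerateQuaternion K where
  toFun X := ⟨!![1, 0; 0, -1] * (X : Matrix (Fin 2) (Fin 2) (DualNumber K)) * !![1, 0; 0, -1], by
    obtain ⟨_, a, b, rfl⟩ := X
    refine ⟨a, -b, Matrix.ext fun i j => ?_⟩
    fin_cases i <;> fin_cases j <;> simp [quatMatrix]⟩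
  map_one' := Subtype.ext (by simp [Matrix.one_fin_two])
  map_mul' X Y := Subtype.ext (by
    have h : (!![1, 0; 0, -1] : Matrix (Fin 2) (Fin 2) (DualNumber K)) * !![1, 0; 0, -1]
        = 1 := by simp [Matrix.one_fin_two]
    simp only [MulMemClass.coe_mul, mul_assoc]
    rw [← mul_assoc !![1, 0; 0, -1] !![1, 0; 0, -1] _, h, one_mul])
  map_zero' := Subtype.ext (by simp only [ZeroMemClass.coe_zero, mul_zero, zero_mul])
  map_add' X Y := Subtype.ext (by simp only [AddMemClass.coe_add, mul_add, add_mul])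
  commutes' k := Subtype.ext (by
    have h : (!![1, 0; 0, -1] : Matrix (Fin 2) (Fin 2) (DualNumber K)) * !![1, 0; 0, -1]
        = 1 := by simp [Matrix.one_fin_two]
    change !![1, 0; 0, -1] * algebraMap K (Matrix (Fin 2) (Fin 2) (DualNumber K)) k *
      !![1, 0; 0, -1] = algebraMap K _ k
    rw [← Algebra.commutes, mul_assoc, h, mul_one])

/-- The embedding of `K × K` that sends `(s, t)` to the matrix with rows
`(s + t, t - s) / 2` and `(t - s, s + t) / 2`. -/
noncomputable def pairEmbedding [Invertible (2 : K)] : K × K →ₐ[K] DegenerateQuaternion K :=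
  AlgHom.codRestrict
    { toFun := fun s => quatMatrix K (TrivSqZeroExt.inl (⅟2 * (s.1 + s.2)))
        (TrivSqZeroExt.inl (⅟2 * (s.2 - s.1)))
      map_one' := by
        refine Matrix.ext fun i j => ?_
        fin_cases i <;> fin_cases j <;> simp [quatMatrix, dualConj, one_add_one_eq_two]
      map_mul' := by
        rintro ⟨a, b⟩ ⟨c, d⟩
        have h : (⅟2 : K) * 2 = 1 := invOf_mul_self 2
        refine Matrix.ext fun i j => TrivSqZeroExt.ext ?_ ?_ <;>
          fin_cases i <;> fin_cases j <;>
          simp [quatMatrix, dualConj, Matrix.mul_apply, Fin.sum_univ_two]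
        · linear_combination (-⅟2 * (a * c + b * d)) * h
        · linear_combination (-⅟2 * (b * d - a * c)) * h
        · linear_combination (-⅟2 * (b * d - a * c)) * h
        · linear_combination (-⅟2 * (a * c + b * d)) * h
      map_zero' := by
        refine Matrix.ext fun i j => ?_
        fin_cases i <;> fin_cases j <;> simp [quatMatrix]
      map_add' := by
        rintro ⟨a, b⟩ ⟨c, d⟩
        refine Matrix.ext fun i j => TrivSqZeroExt.ext ?_ ?_ <;>
          fin_cases i <;> fin_cases j <;> simp [quatMatrix, dualConj] <;> ring
      commutes' := by
        intro k
        have h : (⅟2 : K) * (k + k) = k := by rw [← two_mul, invOf_mul_cancel_left]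
        refine Matrix.ext fun i j => ?_
        fin_cases i <;> fin_cases j <;>
          simp [quatMatrix, dualConj, Matrix.algebraMap_matrix_apply, h,
            TrivSqZeroExt.algebraMap_eq_inl] }
    (DegenerateQuaternion K) (fun _ => ⟨_, _, rfl⟩)

end DegenerateQuaternions

/-! ## The groups -/

section Groups

variable (K : Type u) [CommRing K] (n : ℕ)

/-- The general linear group `GL(n, R)` of a possibly non-commutative ring `R`. -/
abbrev GLn (n : ℕ) (R : Type u) [Ring R] : Type u := (Matrix (Fin n) (Fin n) R)ˣ

/-- The chart of `GL(n, R)`: its inclusion into the `n × n` matrices. -/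
def glChart (n : ℕ) (R : Type u) [Ring R] : GLn n R → Matrix (Fin n) (Fin n) R := Units.val

/-- The involution of `GL(n, D)` that is induced by the conjugation of `D`. -/
noncomputable def glInvolution :
    GLn n (DegenerateQuaternion K) →* GLn n (DegenerateQuaternion K) :=
  Units.map ((quatInvolution K).mapMatrix (m := Fin n)).toRingHom.toMonoidHom

/-- The subgroup `GL(n, K[ε])` of `GL(n, D)`. -/
noncomputable def glDual : Subgroup (GLn n (DegenerateQuaternion K)) :=
  (Units.map ((diagEmbedding K).mapMatrix (m := Fin n)).toRingHom.toMonoidHom).range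

/-- The embedding of `GL(n, K) × GL(n, K)` into `GL(n, D)`. -/
noncomputable def glPair [Invertible (2 : K)] (g h : GLn n K) :
    GLn n (DegenerateQuaternion K) :=
  Units.map ((pairEmbedding K).mapMatrix (m := Fin n)).toRingHom.toMonoidHom
    { val := Matrix.of fun i j => (g.val i j, h.val i j)
      inv := Matrix.of fun i j => (g.inv i j, h.inv i j)
      val_inv := by
        have hg := g.val_inv
        have hh := h.val_inv
        ext i j
        · simpa [Matrix.mul_apply, Prod.fst_sum, Matrix.one_apply, apply_ite Prod.fst]
            using congrFun (congrFun hg i) j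
        · simpa [Matrix.mul_apply, Prod.snd_sum, Matrix.one_apply, apply_ite Prod.snd]
            using congrFun (congrFun hh i) j
      inv_val := by
        have hg := g.inv_val
        have hh := h.inv_val
        ext i j
        · simpa [Matrix.mul_apply, Prod.fst_sum, Matrix.one_apply, apply_ite Prod.fst]
            using congrFun (congrFun hg i) j
        · simpa [Matrix.mul_apply, Prod.snd_sum, Matrix.one_apply, apply_ite Prod.snd]
            using congrFun (congrFun hh i) j }

/-- The tangent bundle `T GL(n, K)`. -/
abbrev TGL : Type u := GLn n K × Matrix (Fin n) (Fin n) K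

/-- The usual symmetric space product of `T GL(n, K)`: the tangent map of `(g, h) ↦ g h⁻¹ g`. -/
noncomputable def usualProduct [TopologicalSpace K] : TGL K n → TGL K n → TGL K n :=
  tangentProduct K (glChart n K) groupProduct

end Groups

end SymBundle

open SymBundle

/-! Let `j` be the degenerate quaternion with `a = 0`, `b = 1`. It satisfies `j² = 1` and
anticommutes with `diag(ε, -ε)`, so the idempotents `(1 ∓ j)/2` turn the degenerate quaternions into
matrices `(p, x; y, q)` over `K` in which products of off-diagonal entries vanish. The involution
exchanges `p` with `q` and `x` with `y`. Both facts pass to matrices of size `n`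
(`matrixQuatCoordinates`, `isSwap_glInvolution`).

For a unit `g = (p, x; y, q)` put `a = p q⁻¹` and `V = (x - p q⁻¹ y) q⁻¹`. The pair `(a, V)` carries
the same information as `g σ(g)⁻¹` (`IsSwap.mul_inv_eq`), hence separates exactly the cosets of the
fixed group, and every pair occurs. The product of the quotient becomes `(a, V)(b, W) = (a b⁻¹ a, V
+ a b⁻¹ V b⁻¹ a - a b⁻¹ W b⁻¹ a)` (`IsSwap.toBundle_mul`). The tangent product has `V b⁻¹ a + a b⁻¹
V` in place of the first two vertical terms. The two agree for `V = 0`, and the terms in `V` cancel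
in the vertical symmetries, so the reflection spaces coincide.

The structures differ in their vertical transvection fields: `(w p + p w)/2` for the usual one, `(w
+ p w p)/2` for the second. Bracketing with the field `(x p + p x)/2` gives a commutator in one case
and an anticommutator in the other. Hence `r` is common, while `m(x, z) w` is `[[x, w], z]/4` in the
first case and `-{{x, w}, z}/4` in the second. At `x = z = 1` these operators are `0` and `-1`, so
the representations are inequivalent.

An isomorphism of bundles may cover any automorphism of the base, so it need not intertwine the two
representations of the same triple system. `not_isSymmetricBundleIso` therefore compares two
products that land in the same fiber, and finds `(1 - t²)² = 0` for every unit `t`; density of the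
units yields `1 = 0`.

On the analytic side, all maps are built from linear maps, products and inversion.
`HasSmoothDifferential` carries smoothness and an explicit differential through these operations
together, and `IsDifferenceQuotient.eq_at_zero` identifies that differential with the chosen one. -/

namespace SymBundle

/-! ### Maps of class `C^k` over a topological ring and the chain rule. -/

section Calculus

variable {K : Type u} [CommRing K] [TopologicalSpace K]
  {E : Type u} [AddCommGroup E] [Module K E] [TopologicalSpace E]
  {F : Type u} [AddCommGroup F] [Module K F] [TopologicalSpace F]
  {G : Type u} [AddCommGroup G] [Module K G] [TopologicalSpace G]

theorem IsDifferenceQuotient.congr {U : Set E} {f f' : E → F} {g : E × E × K → F}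
    (h : IsDifferenceQuotient K U f g) (hf : Set.EqOn f' f U) :
    IsDifferenceQuotient K U f' g where
  continuousOn := h.continuousOn
  eq x v t hz := by rw [hf hz.1, hf hz.2]; exact h.eq x v t hz

theorem CkOn.congr {k : ℕ} {U : Set E} {f f' : E → F} (h : CkOn K k U f)
    (hf : Set.EqOn f' f U) : CkOn K k U f' := by
  cases k with
  | zero => exact ContinuousOn.congr h hf
  | succ k =>
    obtain ⟨g, hg, hk⟩ := h
    exact ⟨g, hg.congr hf, hk⟩

theorem quotientDomain_mono {K : Type u} [CommRing K] {E : Type u} [AddCommGroup E] [Module K E]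
    {U V : Set E} (h : U ⊆ V) :
    quotientDomain K U ⊆ quotientDomain K V := fun _ hz => ⟨h hz.1, h hz.2⟩

theorem CkOn.mono {k : ℕ} {E F : Type u} [AddCommGroup E] [Module K E] [TopologicalSpace E]
    [AddCommGroup F] [Module K F] [TopologicalSpace F] {U V : Set E} {f : E → F}
    (h : CkOn K k V f) (hU : U ⊆ V) : CkOn K k U f := by
  induction k generalizing E with
  | zero => exact ContinuousOn.mono h hU
  | succ k ih =>
    obtain ⟨g, hg, hk⟩ := h
    exact ⟨g, ⟨hg.continuousOn.mono (quotientDomain_mono hU),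
      fun x v t hz => hg.eq x v t (quotientDomain_mono hU hz)⟩, ih hk (quotientDomain_mono hU)⟩

theorem CkOn.continuousLinearMap (k : ℕ) {E : Type u} [AddCommGroup E] [Module K E]
    [TopologicalSpace E] (U : Set E) (A : E →L[K] F) : CkOn K k U A := by
  induction k generalizing E with
  | zero => exact A.continuous.continuousOn
  | succ k ih =>
    refine ⟨A ∘L ContinuousLinearMap.fst K E K ∘L ContinuousLinearMap.snd K E (E × K),
      ⟨ContinuousLinearMap.continuous _ |>.continuousOn, fun x v t _ => by simp⟩, ih _ _⟩

theorem CkOn.const (k : ℕ) {E : Type u} [AddCommGroup E] [Module K E]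
    [TopologicalSpace E] (U : Set E) (c : F) : CkOn K k U (fun _ => c) := by
  cases k with
  | zero => exact continuousOn_const
  | succ k =>
    exact ⟨(0 : E × E × K →L[K] F), ⟨ContinuousLinearMap.continuous _ |>.continuousOn,
      fun x v t _ => by simp⟩, CkOn.continuousLinearMap _ _ _⟩

theorem IsDifferenceQuotient.prodMk {U : Set E} {f : E → F} {f' : E → G}
    {g : E × E × K → F} {g' : E × E × K → G} (h : IsDifferenceQuotient K U f g)
    (h' : IsDifferenceQuotient K U f' g') :
    IsDifferenceQuotient K U (fun x => (f x, f' x)) (fun z => (g z, g' z)) where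
  continuousOn := h.continuousOn.prodMk h'.continuousOn
  eq x v t hz := Prod.ext (h.eq x v t hz) (h'.eq x v t hz)

theorem CkOn.prodMk {k : ℕ} {E : Type u} [AddCommGroup E] [Module K E] [TopologicalSpace E]
    {U : Set E} {f : E → F} {f' : E → G} (h : CkOn K k U f) (h' : CkOn K k U f') :
    CkOn K k U (fun x => (f x, f' x)) := by
  induction k generalizing E with
  | zero => exact ContinuousOn.prodMk h h'
  | succ k ih =>
    obtain ⟨g, hg, hk⟩ := h
    obtain ⟨g', hg', hk'⟩ := h'
    exact ⟨_, hg.prodMk hg', ih hk hk'⟩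

/-- Taking `t = 1` and `v = y - x` writes `f y` as `f x + g (x, y - x, 1)`, which is continuous in
`y`. -/
theorem IsDifferenceQuotient.continuousOn_self [ContinuousAdd F] [IsTopologicalAddGroup E]
    {U : Set E} {f : E → F}
    {g : E × E × K → F} (h : IsDifferenceQuotient K U f g) : ContinuousOn f U := by
  intro x hx
  have hc : ContinuousOn (fun y => f x + g (x, y - x, 1)) U :=
    continuousOn_const.add (h.continuousOn.comp (by fun_prop)
      (fun y hy => ⟨hx, by simpa using hy⟩))
  refine (hc.congr fun y hy => ?_) x hx
  have := h.eq x (y - x) 1 ⟨hx, by simpa using hy⟩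
  simp only [one_smul, add_sub_cancel] at this
  rw [← this, add_sub_cancel]

/-- Needed for the chain rule: the difference quotient of a composite involves the inner map itself
besides its quotient. -/
theorem CkOn.of_succ {k : ℕ} {E : Type u} [AddCommGroup E] [Module K E] [TopologicalSpace E]
    [ContinuousAdd F] [IsTopologicalRing K] [IsTopologicalAddGroup E] {U : Set E} {f : E → F}
    (h : CkOn K (k + 1) U f) : CkOn K k U f := by
  induction k generalizing E with
  | zero =>
    obtain ⟨g, hg, -⟩ := h
    exact hg.continuousOn_self
  | succ k ih =>
    obtain ⟨g, hg, hk⟩ := h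
    exact ⟨g, hg, ih hk⟩

/-- The map of difference quotient domains that is induced by a map with difference quotient
`g`. -/
def quotientMap (f : E → F) (g : E × E × K → F) (z : E × E × K) : F × F × K :=
  (f z.1, g z, z.2.2)

theorem IsDifferenceQuotient.mapsTo {U : Set E} {V : Set F} {f : E → F} {g : E × E × K → F}
    (h : IsDifferenceQuotient K U f g) (hU : Set.MapsTo f U V) :
    Set.MapsTo (quotientMap f g) (quotientDomain K U) (quotientDomain K V) := by
  rintro ⟨x, v, t⟩ hz
  refine ⟨hU hz.1, ?_⟩
  change f x + t • g (x, v, t) ∈ V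
  rw [← h.eq x v t hz, add_sub_cancel]
  exact hU hz.2

/-- Since `f (x + t v) = f x + t g(x, v, t)`, the increment of the outer map is taken at `f x` in
direction `g(x, v, t)` with the same `t`. -/
theorem IsDifferenceQuotient.comp [ContinuousAdd F] [IsTopologicalAddGroup E]
    {U : Set E} {V : Set F} {f : E → F} {g : E × E × K → F} {f' : F → G} {g' : F × F × K → G}
    (h' : IsDifferenceQuotient K V f' g') (h : IsDifferenceQuotient K U f g)
    (hU : Set.MapsTo f U V) :
    IsDifferenceQuotient K U (f' ∘ f) (g' ∘ quotientMap f g) where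
  continuousOn := by
    refine h'.continuousOn.comp (ContinuousOn.prodMk ?_ (h.continuousOn.prodMk (by fun_prop)))
      (h.mapsTo hU)
    exact h.continuousOn_self.comp (by fun_prop) (fun z hz => hz.1)
  eq x v t hz := by
    have h1 := h.eq x v t hz
    have h2 := h'.eq (f x) (g (x, v, t)) t (h.mapsTo hU hz)
    rw [← h1, add_sub_cancel] at h2
    exact h2

/-- The quotient of a composite is again a composite, of `g'` with `quotientMap f g`, so induction
on `k` applies; the spaces vary because each quotient lives on a larger space. -/
theorem CkOn.comp [IsTopologicalRing K] {k : ℕ} {E F G : Type u} [AddCommGroup E] [Module K E]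
    [TopologicalSpace E] [IsTopologicalAddGroup E] [AddCommGroup F] [Module K F]
    [TopologicalSpace F] [IsTopologicalAddGroup F] [AddCommGroup G] [Module K G]
    [TopologicalSpace G]
    {U : Set E} {V : Set F} {f : E → F} {f' : F → G}
    (h' : CkOn K k V f') (h : CkOn K k U f) (hU : Set.MapsTo f U V) :
    CkOn K k U (f' ∘ f) := by
  induction k generalizing E F G with
  | zero => exact ContinuousOn.comp h' h hU
  | succ k ih =>
    have hf := h.of_succ
    obtain ⟨g, hg, hk⟩ := h
    obtain ⟨g', hg', hk'⟩ := h'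
    refine ⟨_, hg'.comp hg hU, ih hk' (CkOn.prodMk ?_ (CkOn.prodMk hk ?_)) (hg.mapsTo hU)⟩
    · exact ih hf (CkOn.continuousLinearMap k (quotientDomain K U)
        (ContinuousLinearMap.fst K E (E × K))) (fun z hz => hz.1)
    · exact CkOn.continuousLinearMap k _
        (ContinuousLinearMap.snd K E K ∘L ContinuousLinearMap.snd K E (E × K))

/-! ### Bilinear maps -/

/-- The quotient `b(x', y) + b(x, y') + t b(x', y')` is assembled from `b`, linear maps and scalar
multiplication, all of class `C^k` by induction. -/
theorem CkOn.bilinear [IsTopologicalRing K] (k : ℕ) {E F G : Type u} [AddCommGroup E] [Module K E]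
    [TopologicalSpace E] [IsTopologicalAddGroup E] [AddCommGroup F] [Module K F]
    [TopologicalSpace F] [IsTopologicalAddGroup F] [AddCommGroup G] [Module K G]
    [TopologicalSpace G] [IsTopologicalAddGroup G] [ContinuousSMul K G]
    (b : E →ₗ[K] F →ₗ[K] G) (hb : Continuous fun p : E × F => b p.1 p.2) (U : Set (E × F)) :
    CkOn K k U (fun p => b p.1 p.2) := by
  induction k generalizing E F G with
  | zero => exact hb.continuousOn
  | succ k ih =>
    refine ⟨fun z => b z.2.1.1 z.1.2 + (b z.1.1 z.2.1.2 + z.2.2 • b z.2.1.1 z.2.1.2),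
      ⟨?_, ?_⟩, ?_⟩
    · have h1 : Continuous fun z : (E × F) × (E × F) × K => b z.2.1.1 z.1.2 :=
        hb.comp (by fun_prop : Continuous fun z : (E × F) × (E × F) × K => (z.2.1.1, z.1.2))
      have h2 : Continuous fun z : (E × F) × (E × F) × K => b z.1.1 z.2.1.2 :=
        hb.comp (by fun_prop : Continuous fun z : (E × F) × (E × F) × K => (z.1.1, z.2.1.2))
      have h3 : Continuous fun z : (E × F) × (E × F) × K => b z.2.1.1 z.2.1.2 :=
        hb.comp (by fun_prop : Continuous fun z : (E × F) × (E × F) × K => (z.2.1.1, z.2.1.2))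
      exact (h1.add (h2.add ((by fun_prop : Continuous fun z : (E × F) × (E × F) × K =>
        z.2.2).smul h3))).continuousOn
    · rintro ⟨x, y⟩ ⟨x', y'⟩ t -
      simp only [Prod.smul_mk, Prod.mk_add_mk, map_add, map_smul, LinearMap.add_apply,
        LinearMap.smul_apply, smul_add]
      abel
    · have hadd : ∀ {D : Type u} [AddCommGroup D] [Module K D] [TopologicalSpace D]
          [IsTopologicalAddGroup D] {V : Set D} {f g : D → G}, CkOn K k V f → CkOn K k V g →
          CkOn K k V (fun x => f x + g x) := fun hf hg =>
        CkOn.comp (CkOn.continuousLinearMap k Set.univ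
          (ContinuousLinearMap.fst K G G + ContinuousLinearMap.snd K G G)) (hf.prodMk hg)
          (Set.mapsTo_univ _ _)
      have hlin : ∀ (A : (E × F) × (E × F) × K →L[K] E) (B : (E × F) × (E × F) × K →L[K] F),
          CkOn K k (quotientDomain K U) (fun z => b (A z) (B z)) := fun A B =>
        CkOn.comp (ih b hb Set.univ) (CkOn.continuousLinearMap k _ (A.prod B))
          (Set.mapsTo_univ _ _)
      -- Scalar multiplication is itself bilinear, so the induction hypothesis covers it; this is
      -- why the spaces are generalized.
      have hsmul : CkOn K k Set.univ (fun p : K × G => p.1 • p.2) :=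
        ih (LinearMap.lsmul K G) continuous_smul Set.univ
      let p1 := ContinuousLinearMap.fst K (E × F) ((E × F) × K)
      let p2 := ContinuousLinearMap.fst K (E × F) K ∘L
        ContinuousLinearMap.snd K (E × F) ((E × F) × K)
      let p3 := ContinuousLinearMap.snd K (E × F) K ∘L
        ContinuousLinearMap.snd K (E × F) ((E × F) × K)
      let q := ContinuousLinearMap.fst K E F
      let r := ContinuousLinearMap.snd K E F
      exact hadd (hlin (q ∘L p2) (r ∘L p1)) (hadd (hlin (q ∘L p1) (r ∘L p2))
        (CkOn.comp hsmul ((CkOn.continuousLinearMap k _ p3).prodMk (hlin (q ∘L p2) (r ∘L p2)))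
          (Set.mapsTo_univ _ _)))

/-! ### Smooth maps together with their differential -/

/-- `f` is smooth on `U`, with differential `f' x v`. -/
structure HasSmoothDifferential (K : Type u) [CommRing K] [TopologicalSpace K]
    {E F : Type u} [AddCommGroup E] [Module K E] [TopologicalSpace E]
    [AddCommGroup F] [Module K F] [TopologicalSpace F]
    (U : Set E) (f : E → F) (f' : E → E → F) : Prop where
  smooth : SmoothOn K U f
  quotient : ∃ g, IsDifferenceQuotient K U f g ∧ ∀ x ∈ U, ∀ v, g (x, v, 0) = f' x v

namespace HasSmoothDifferential

theorem congr {U : Set E} {f f₁ : E → F} {f' f₁' : E → E → F}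
    (h : HasSmoothDifferential K U f f') (hf : Set.EqOn f₁ f U)
    (hf' : ∀ x ∈ U, ∀ v, f₁' x v = f' x v) : HasSmoothDifferential K U f₁ f₁' where
  smooth k := (h.smooth k).congr hf
  quotient := by
    obtain ⟨g, hg, hg'⟩ := h.quotient
    exact ⟨g, hg.congr hf, fun x hx v => by rw [hg' x hx, hf' x hx]⟩

theorem mono {U V : Set E} {f : E → F} {f' : E → E → F}
    (h : HasSmoothDifferential K V f f') (hU : U ⊆ V) : HasSmoothDifferential K U f f' where
  smooth k := (h.smooth k).mono hU
  quotient := by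
    obtain ⟨g, hg, hg'⟩ := h.quotient
    exact ⟨g, ⟨hg.continuousOn.mono (quotientDomain_mono hU),
      fun x v t hz => hg.eq x v t (quotientDomain_mono hU hz)⟩, fun x hx => hg' x (hU hx)⟩

theorem const (U : Set E) (c : F) :
    HasSmoothDifferential K U (fun _ => c) (fun _ _ => 0) where
  smooth k := CkOn.const k U c
  quotient := ⟨fun _ => 0, ⟨continuousOn_const, fun x v t _ => by simp⟩, fun _ _ _ => rfl⟩

theorem continuousLinearMap (U : Set E) (A : E →L[K] F) :
    HasSmoothDifferential K U (fun x => A x) (fun _ v => A v) where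
  smooth k := CkOn.continuousLinearMap k U A
  quotient := ⟨A ∘L ContinuousLinearMap.fst K E K ∘L ContinuousLinearMap.snd K E (E × K),
      ⟨ContinuousLinearMap.continuous _ |>.continuousOn, fun x v t _ => by simp⟩,
      fun _ _ _ => rfl⟩

theorem id (U : Set E) : HasSmoothDifferential K U (fun x => x) (fun _ v => v) :=
  continuousLinearMap U (ContinuousLinearMap.id K E)

theorem prodMk {U : Set E} {f : E → F} {f' : E → E → F} {g : E → G} {g' : E → E → G}
    (hf : HasSmoothDifferential K U f f') (hg : HasSmoothDifferential K U g g') :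
    HasSmoothDifferential K U (fun x => (f x, g x)) (fun x v => (f' x v, g' x v)) where
  smooth k := (hf.smooth k).prodMk (hg.smooth k)
  quotient := by
    obtain ⟨q, hq, hq'⟩ := hf.quotient
    obtain ⟨r, hr, hr'⟩ := hg.quotient
    exact ⟨_, hq.prodMk hr, fun x hx v => Prod.ext (hq' x hx v) (hr' x hx v)⟩

section

variable [IsTopologicalRing K] [IsTopologicalAddGroup E] [IsTopologicalAddGroup F]

theorem comp {U : Set E} {V : Set F} {f : E → F} {f' : E → E → F} {g : F → G} {g' : F → F → G}
    (hg : HasSmoothDifferential K V g g') (hf : HasSmoothDifferential K U f f')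
    (hU : Set.MapsTo f U V) :
    HasSmoothDifferential K U (fun x => g (f x)) (fun x v => g' (f x) (f' x v)) where
  smooth k := (hg.smooth k).comp (hf.smooth k) hU
  quotient := by
    obtain ⟨q, hq, hq'⟩ := hf.quotient
    obtain ⟨r, hr, hr'⟩ := hg.quotient
    refine ⟨_, hr.comp hq hU, fun x hx v => ?_⟩
    change r (f x, q (x, v, 0), 0) = _
    rw [hr' _ (hU hx), hq' x hx]

theorem map [IsTopologicalAddGroup G] {U : Set E} {f : E → F} {f' : E → E → F} (A : F →L[K] G)
    (hf : HasSmoothDifferential K U f f') :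
    HasSmoothDifferential K U (fun x => A (f x)) (fun x v => A (f' x v)) :=
  comp (continuousLinearMap Set.univ A) hf (Set.mapsTo_univ _ _)

theorem fst [IsTopologicalAddGroup G] {U : Set E} {f : E → F × G} {f' : E → E → F × G}
    (hf : HasSmoothDifferential K U f f') :
    HasSmoothDifferential K U (fun x => (f x).1) (fun x v => (f' x v).1) :=
  hf.map (ContinuousLinearMap.fst K F G)

theorem snd [IsTopologicalAddGroup G] {U : Set E} {f : E → F × G} {f' : E → E → F × G}
    (hf : HasSmoothDifferential K U f f') :
    HasSmoothDifferential K U (fun x => (f x).2) (fun x v => (f' x v).2) :=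
  hf.map (ContinuousLinearMap.snd K F G)

theorem add {U : Set E} {f g : E → F} {f' g' : E → E → F}
    (hf : HasSmoothDifferential K U f f') (hg : HasSmoothDifferential K U g g') :
    HasSmoothDifferential K U (fun x => f x + g x) (fun x v => f' x v + g' x v) :=
  (hf.prodMk hg).map (ContinuousLinearMap.fst K F F + ContinuousLinearMap.snd K F F)

theorem sub {U : Set E} {f g : E → F} {f' g' : E → E → F}
    (hf : HasSmoothDifferential K U f f') (hg : HasSmoothDifferential K U g g') :
    HasSmoothDifferential K U (fun x => f x - g x) (fun x v => f' x v - g' x v) :=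
  (hf.prodMk hg).map (ContinuousLinearMap.fst K F F - ContinuousLinearMap.snd K F F)

theorem neg {U : Set E} {f : E → F} {f' : E → E → F} (hf : HasSmoothDifferential K U f f') :
    HasSmoothDifferential K U (fun x => -f x) (fun x v => -f' x v) :=
  hf.map (-ContinuousLinearMap.id K F)

end

section Algebra

variable [IsTopologicalRing K] [IsTopologicalAddGroup E]
  {R : Type u} [Ring R] [Algebra K R] [TopologicalSpace R] [IsTopologicalRing R]
  [ContinuousSMul K R]

theorem mul {U : Set E} {f g : E → R} {f' g' : E → E → R}
    (hf : HasSmoothDifferential K U f f') (hg : HasSmoothDifferential K U g g') :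
    HasSmoothDifferential K U (fun x => f x * g x) (fun x v => f x * g' x v + f' x v * g x) := by
  have key : HasSmoothDifferential K (Set.univ : Set (R × R)) (fun p => p.1 * p.2)
      (fun p v => p.1 * v.2 + v.1 * p.2) := by
    refine ⟨fun k => CkOn.bilinear k (LinearMap.mul K R) continuous_mul _,
      fun z => z.1.1 * z.2.1.2 + z.2.1.1 * z.1.2 + z.2.2 • (z.2.1.1 * z.2.1.2), ⟨?_, ?_⟩, ?_⟩
    · exact Continuous.continuousOn (by fun_prop)
    · rintro ⟨x, y⟩ ⟨x', y'⟩ t -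
      simp only [Prod.smul_mk, Prod.mk_add_mk, add_mul, mul_add, smul_mul_assoc, mul_smul_comm,
        smul_add]
      abel
    · simp
  exact key.comp (hf.prodMk hg) (Set.mapsTo_univ _ _)

end Algebra

end HasSmoothDifferential

/-! ### Continuous inverse algebras -/

/-- The group of units of `R` is open, and inversion is continuous on it. -/
structure HasContinuousInverse (R : Type u) [Ring R] [TopologicalSpace R] : Prop where
  isOpen : IsOpen {x : R | IsUnit x}
  continuousOn : ContinuousOn (Ring.inverse : R → R) {x : R | IsUnit x}

section Inverse

variable [IsTopologicalRing K] {R : Type u} [Ring R] [Algebra K R] [TopologicalSpace R]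
  [IsTopologicalRing R] [ContinuousSMul K R]

/-- The resolvent identity `b⁻¹ - a⁻¹ = -b⁻¹ (b - a) a⁻¹`, with `b - a = t v`. -/
theorem HasContinuousInverse.isDifferenceQuotient {K : Type u} [CommRing K] [TopologicalSpace K]
    {R : Type u} [Ring R] [Algebra K R] [TopologicalSpace R] [IsTopologicalRing R]
    [ContinuousSMul K R] (hR : HasContinuousInverse R) :
    IsDifferenceQuotient K {x : R | IsUnit x} Ring.inverse
      (fun z => -(Ring.inverse (z.1 + z.2.2 • z.2.1) * z.2.1 * Ring.inverse z.1)) where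
  continuousOn := by
    have h1 : ContinuousOn (fun z : R × R × K => Ring.inverse (z.1 + z.2.2 • z.2.1))
        (quotientDomain K {x : R | IsUnit x}) :=
      hR.continuousOn.comp (by fun_prop) (fun z hz => hz.2)
    have h2 : ContinuousOn (fun z : R × R × K => Ring.inverse z.1)
        (quotientDomain K {x : R | IsUnit x}) :=
      hR.continuousOn.comp (by fun_prop) (fun z hz => hz.1)
    exact ((h1.mul (by fun_prop)).mul h2).neg
  eq x v t hz := by
    obtain ⟨⟨a, ha⟩, ⟨b, hb⟩⟩ := hz
    dsimp only at ha hb ⊢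
    have htv : t • v = b.val - a.val := by rw [ha, hb]; abel
    rw [← hb, ← ha, Ring.inverse_unit, Ring.inverse_unit, smul_neg, ← smul_mul_assoc,
      ← mul_smul_comm, htv]
    simp [mul_sub, sub_mul, mul_assoc]

/-- Bootstrapping: the difference quotient of inversion is a product of inverses and linear maps, so
inversion of class `C^k` is of class `C^(k+1)`. -/
theorem HasContinuousInverse.hasSmoothDifferential (hR : HasContinuousInverse R) :
    HasSmoothDifferential K {x : R | IsUnit x} Ring.inverse
      (fun x v => -(Ring.inverse x * v * Ring.inverse x)) where
  smooth k := by
    induction k with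
    | zero => exact hR.continuousOn
    | succ k ih =>
      refine ⟨_, hR.isDifferenceQuotient, ?_⟩
      let p1 := ContinuousLinearMap.fst K R (R × K)
      let p2 := ContinuousLinearMap.fst K R K ∘L ContinuousLinearMap.snd K R (R × K)
      let p3 := ContinuousLinearMap.snd K R K ∘L ContinuousLinearMap.snd K R (R × K)
      have lin : ∀ {F : Type u} [AddCommGroup F] [Module K F] [TopologicalSpace F]
          (A : R × R × K →L[K] F), CkOn K k (quotientDomain K {x : R | IsUnit x}) A :=
        fun A => CkOn.continuousLinearMap k _ A
      have hmul : CkOn K k Set.univ (fun p : R × R => p.1 * p.2) :=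
        CkOn.bilinear k (LinearMap.mul K R) continuous_mul _
      have hsmul : CkOn K k Set.univ (fun p : K × R => p.1 • p.2) :=
        CkOn.bilinear k (LinearMap.lsmul K R) continuous_smul _
      have hadd : CkOn K k Set.univ (fun p : R × R => p.1 + p.2) :=
        CkOn.continuousLinearMap k Set.univ
          (ContinuousLinearMap.fst K R R + ContinuousLinearMap.snd K R R)
      have hneg : CkOn K k Set.univ (fun p : R => -p) :=
        CkOn.continuousLinearMap k Set.univ (-ContinuousLinearMap.id K R)
      have h1 := hadd.comp ((lin p1).prodMk
        (hsmul.comp ((lin p3).prodMk (lin p2)) (Set.mapsTo_univ _ _))) (Set.mapsTo_univ _ _)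
      have h2 := ih.comp h1 (fun z hz => hz.2)
      have h3 := ih.comp (lin p1) (fun z hz => hz.1)
      exact hneg.comp (hmul.comp ((hmul.comp (h2.prodMk (lin p2)) (Set.mapsTo_univ _ _)).prodMk h3)
        (Set.mapsTo_univ _ _)) (Set.mapsTo_univ _ _)
  quotient := ⟨_, hR.isDifferenceQuotient, fun x _ v => by simp⟩

theorem HasSmoothDifferential.inverse [IsTopologicalAddGroup E] (hR : HasContinuousInverse R)
    {U : Set E} {f : E → R} {f' : E → E → R} (hf : HasSmoothDifferential K U f f')
    (hU : ∀ x ∈ U, IsUnit (f x)) :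
    HasSmoothDifferential K U (fun x => Ring.inverse (f x))
      (fun x v => -(Ring.inverse (f x) * f' x v * Ring.inverse (f x))) :=
  hR.hasSmoothDifferential.comp hf hU

end Inverse

/-! ### Uniqueness of the differential -/

/-- For a unit `t` the defining equation can be divided by `t`, so two extensions agree there. Units
accumulate at `0` among the admissible `t`, and limits in a Hausdorff space are unique. -/
theorem IsDifferenceQuotient.eq_at_zero [IsTopologicalRing K]
    (hK : Dense {x : K | IsUnit x}) [ContinuousAdd E] [ContinuousSMul K E] [T2Space F]
    {U : Set E} (hU : IsOpen U) {f : E → F} {g g' : E × E × K → F}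
    (h : IsDifferenceQuotient K U f g) (h' : IsDifferenceQuotient K U f g')
    {x : E} (hx : x ∈ U) (v : E) : g (x, v, 0) = g' (x, v, 0) := by
  have hc : Continuous fun t : K => x + t • v := by fun_prop
  have hO : IsOpen {t : K | x + t • v ∈ U} := hU.preimage hc
  have h0 : (0 : K) ∈ {t : K | x + t • v ∈ U} := by simpa using hx
  have hcont : ∀ {q : E × E × K → F}, IsDifferenceQuotient K U f q →
      ContinuousOn (fun t : K => q (x, v, t)) {t : K | x + t • v ∈ U} := fun hq =>
    hq.continuousOn.comp (by fun_prop) (fun t ht => ⟨hx, ht⟩)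
  have hcl : (0 : K) ∈ closure ({t : K | x + t • v ∈ U} ∩ {t : K | IsUnit t} : Set K) :=
    hK.open_subset_closure_inter hO h0
  have : (nhdsWithin (0 : K) ({t : K | x + t • v ∈ U} ∩ {t : K | IsUnit t} : Set K)).NeBot :=
    mem_closure_iff_nhdsWithin_neBot.mp hcl
  have hle : nhdsWithin (0 : K) ({t : K | x + t • v ∈ U} ∩ {t : K | IsUnit t} : Set K) ≤
      nhdsWithin 0 {t : K | x + t • v ∈ U} := nhdsWithin_mono _ Set.inter_subset_left
  refine tendsto_nhds_unique_of_eventuallyEq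
    (((hcont h) 0 h0).mono_left hle) (((hcont h') 0 h0).mono_left hle) ?_
  filter_upwards [self_mem_nhdsWithin] with t ht
  obtain ⟨htU, c, rfl⟩ := ht
  have e := (h.eq x v c ⟨hx, htU⟩).symm.trans (h'.eq x v c ⟨hx, htU⟩)
  have e' := congrArg (fun y => (c⁻¹).val • y) e
  simpa [smul_smul] using e'

theorem HasSmoothDifferential.differential_eq [IsTopologicalRing K]
    (hK : Dense {x : K | IsUnit x}) [ContinuousAdd E] [ContinuousSMul K E] [T2Space F]
    {U : Set E} (hU : IsOpen U) {f : E → F} {f' : E → E → F}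
    (h : HasSmoothDifferential K U f f') {x : E} (hx : x ∈ U) (v : E) :
    differential K U f x v = f' x v := by
  obtain ⟨g, hg, hg'⟩ := h.quotient
  have H : ∃ g, IsDifferenceQuotient K U f g := ⟨g, hg⟩
  rw [differential, dif_pos H, ← hg' x hx]
  exact H.choose_spec.eq_at_zero hK hU hg hx v

end Calculus

/-! ### Tangent maps and brackets of vector fields in a global chart. -/

section Charts

variable {K : Type u} [CommRing K] [TopologicalSpace K]
  {E : Type u} [AddCommGroup E] [Module K E] [TopologicalSpace E]
  {E' : Type u} [AddCommGroup E'] [Module K E'] [TopologicalSpace E']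
  {M N : Type u} {φ : M → E} {ψ : N → E'} {f : M → N} {F : E → E'} {F' : E → E → E'}

theorem HasSmoothDifferential.inCharts (h : HasSmoothDifferential K (Set.range φ) F F')
    (hφ : Function.Injective φ) (hf : ∀ p, ψ (f p) = F (φ p)) :
    HasSmoothDifferential K (Set.range φ) (inCharts φ ψ f) F' :=
  h.congr (by rintro _ ⟨p, rfl⟩; simp [SymBundle.inCharts, hφ.extend_apply, hf])
    (fun _ _ _ => rfl)

theorem HasSmoothDifferential.smoothMap (h : HasSmoothDifferential K (Set.range φ) F F')
    (hφ : Function.Injective φ) (hf : ∀ p, ψ (f p) = F (φ p)) : SmoothMap K φ ψ f :=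
  (h.inCharts hφ hf).smooth

theorem HasSmoothDifferential.tangentMap_eq [IsTopologicalRing K] [ContinuousAdd E]
    [ContinuousSMul K E] [T2Space E'] (hK : Dense {x : K | IsUnit x})
    (h : HasSmoothDifferential K (Set.range φ) F F')
    (hφ : IsGlobalChart φ) (hf : ∀ p, ψ (f p) = F (φ p)) (p : M) (v : E) :
    tangentMap K φ ψ f p v = F' (φ p) v :=
  (h.inCharts hφ.1 hf).differential_eq hK hφ.2 ⟨p, rfl⟩ v

theorem fieldBracket_eq [IsTopologicalRing K] [ContinuousAdd E]
    [ContinuousSMul K E] [T2Space E] (hK : Dense {x : K | IsUnit x}) (hφ : IsGlobalChart φ)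
    {X Y : E → E} {X' Y' : E → E → E} (hX : HasSmoothDifferential K (Set.range φ) X X')
    (hY : HasSmoothDifferential K (Set.range φ) Y Y') :
    fieldBracket K φ (fun p => X (φ p)) (fun p => Y (φ p))
      = fun p => X' (φ p) (Y (φ p)) - Y' (φ p) (X (φ p)) := by
  funext p
  rw [fieldBracket, hX.tangentMap_eq (ψ := (id : E → E)) hK hφ (fun _ => rfl),
    hY.tangentMap_eq (ψ := (id : E → E)) hK hφ (fun _ => rfl)]

theorem IsGlobalChart.prodMap {E E' M N : Type u} [TopologicalSpace E] [TopologicalSpace E']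
    {φ : M → E} {ψ : N → E'} (hφ : IsGlobalChart φ) (hψ : IsGlobalChart ψ) :
    IsGlobalChart (Prod.map φ ψ) :=
  ⟨hφ.1.prodMap hψ.1, by rw [Set.range_prodMap]; exact hφ.2.prod hψ.2⟩

theorem IsGlobalChart.bundleChart {E W M : Type u} [TopologicalSpace E] [TopologicalSpace W]
    {φ : M → E} (hφ : IsGlobalChart φ) : IsGlobalChart (bundleChart (W := W) φ) :=
  hφ.prodMap ⟨Function.injective_id, by simp⟩

end Charts

/-! ### The group of units of a continuous inverse algebra as a symmetric space. -/

section UnitGroups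

theorem HasContinuousInverse.isGlobalChart {R : Type u} [Ring R] [TopologicalSpace R]
    (hR : HasContinuousInverse R) : IsGlobalChart (Units.val : Rˣ → R) :=
  ⟨Units.val_injective, hR.isOpen⟩

variable {K : Type u} [CommRing K] [TopologicalSpace K] [IsTopologicalRing K]
  {R : Type u} [Ring R] [Algebra K R] [TopologicalSpace R] [IsTopologicalRing R]
  [ContinuousSMul K R]

theorem HasContinuousInverse.smoothMap_mul (hR : HasContinuousInverse R) :
    SmoothMap K (Prod.map Units.val Units.val) Units.val (fun a : Rˣ × Rˣ => a.1 * a.2) :=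
  ((HasSmoothDifferential.id _).fst.mul (HasSmoothDifferential.id _).snd).smoothMap
    (hR.isGlobalChart.prodMap hR.isGlobalChart).1 (fun _ => rfl)

theorem HasContinuousInverse.smoothMap_inv (hR : HasContinuousInverse R) :
    SmoothMap K Units.val Units.val (fun g : Rˣ => g⁻¹) :=
  hR.hasSmoothDifferential.smoothMap hR.isGlobalChart.1 (fun g => (Ring.inverse_unit g).symm)

theorem HasContinuousInverse.hasSmoothDifferential_groupProduct (hR : HasContinuousInverse R) :
    HasSmoothDifferential K (Set.range (Prod.map (Units.val : Rˣ → R) (Units.val : Rˣ → R)))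
      (fun z => z.1 * Ring.inverse z.2 * z.1)
      (fun z v => v.1 * Ring.inverse z.2 * z.1 + z.1 * Ring.inverse z.2 * v.1
        - z.1 * Ring.inverse z.2 * v.2 * Ring.inverse z.2 * z.1) := by
  have h1 := (HasSmoothDifferential.id (K := K)
    (Set.range (Prod.map (Units.val : Rˣ → R) (Units.val : Rˣ → R)))).fst
  have h2 := (HasSmoothDifferential.id (K := K)
    (Set.range (Prod.map (Units.val : Rˣ → R) (Units.val : Rˣ → R)))).snd
  refine ((h1.mul (h2.inverse hR ?_)).mul h1).congr (fun _ _ => rfl) fun x _ v => by noncomm_ring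
  rintro _ ⟨a, rfl⟩
  exact a.2.isUnit


/-- The linear vector field `p ↦ a p + p b` has differential `v ↦ a v + v b`. -/
theorem hasSmoothDifferential_mul_add_mul (U : Set R) (a b : R) :
    HasSmoothDifferential K U (fun p => a * p + p * b) (fun _ v => a * v + v * b) :=
  (((HasSmoothDifferential.const U a).mul (HasSmoothDifferential.id U)).add
    ((HasSmoothDifferential.id U).mul (HasSmoothDifferential.const U b))).congr
    (fun _ _ => rfl) (fun _ _ _ => by simp)

variable [T2Space R]

theorem HasContinuousInverse.tangentMap_groupProduct (hK : Dense {x : K | IsUnit x})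
    (hR : HasContinuousInverse R) (a : Rˣ × Rˣ) (v : R × R) :
    tangentMap K (Prod.map Units.val Units.val) Units.val
      (Function.uncurry (groupProduct (G := Rˣ))) a v =
      v.1 * (a.2⁻¹).val * a.1 + a.1 * (a.2⁻¹).val * v.1
        - a.1 * (a.2⁻¹).val * v.2 * (a.2⁻¹).val * a.1 := by
  rw [hR.hasSmoothDifferential_groupProduct.tangentMap_eq hK
    (hR.isGlobalChart.prodMap hR.isGlobalChart) (by rintro ⟨a, b⟩; simp [groupProduct])]
  simp

theorem HasContinuousInverse.isSymmetricSpace (hK : Dense {x : K | IsUnit x})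
    (hR : HasContinuousInverse R) :
    IsSymmetricSpace K (Units.val : Rˣ → R) groupProduct where
  chart := hR.isGlobalChart
  smooth := hR.hasSmoothDifferential_groupProduct.smoothMap
    (hR.isGlobalChart.prodMap hR.isGlobalChart).1 (by rintro ⟨a, b⟩; simp [groupProduct])
  idem x := by simp [groupProduct]
  invol x y := by simp [groupProduct, mul_assoc]
  distrib x y z := by simp [groupProduct, mul_assoc]
  differential x v := by
    have h := ((HasSmoothDifferential.const (K := K) (Set.range (Units.val : Rˣ → R)) x.val).prodMk
      (HasSmoothDifferential.id _))
    have h' := hR.hasSmoothDifferential_groupProduct.comp h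
      (by rintro _ ⟨y, rfl⟩; exact ⟨(x, y), rfl⟩)
    rw [h'.tangentMap_eq hK hR.isGlobalChart (by intro a; simp [groupProduct])]
    simp

theorem invOf_two_smul_add_invOf_two_smul {K W : Type*} [CommRing K] [Invertible (2 : K)]
    [AddCommGroup W] [Module K W] (w : W) : ⅟(2 : K) • w + ⅟(2 : K) • w = w := by
  rw [← two_smul K (⅟(2 : K) • w), smul_smul, mul_invOf_self, one_smul]

variable [Invertible (2 : K)]

/-- Two symmetries over the identity bring the base point back to `p`; only the half vector at the
identity contributes, once from the left and once from the right. -/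
theorem HasContinuousInverse.transvectionField_eq (hK : Dense {x : K | IsUnit x})
    (hR : HasContinuousInverse R) (u : R) :
    transvectionField K (Units.val : Rˣ → R) groupProduct 1 u
      = fun p => (⅟(2 : K) • u) * p.val + p.val * (⅟(2 : K) • u) := by
  funext p
  simp [transvectionField, tangentProduct, hR.tangentMap_groupProduct hK, groupProduct]

/-- The fields `a p + p a` and `b p + p b` have bracket `[a, b] p - p [a, b]`; the factor `1/4`
comes from the two halves in `a = u/2` and `b = v/2`. -/
theorem HasContinuousInverse.ltsBracket_eq (hK : Dense {x : K | IsUnit x})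
    (hR : HasContinuousInverse R) (u v w : R) :
    ltsBracket K (Units.val : Rˣ → R) groupProduct 1 u v w
      = (⅟(2 : K) * ⅟(2 : K)) • ((u * v - v * u) * w - w * (u * v - v * u)) := by
  have key : ∀ x y : R, fieldBracket K (Units.val : Rˣ → R)
      (transvectionField K (Units.val : Rˣ → R) groupProduct 1 x)
      (transvectionField K (Units.val : Rˣ → R) groupProduct 1 y)
      = fun p => ((⅟(2 : K) * ⅟(2 : K)) • (x * y - y * x)) * p.val
        + p.val * -((⅟(2 : K) * ⅟(2 : K)) • (x * y - y * x)) := by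
    intro x y
    rw [hR.transvectionField_eq hK, hR.transvectionField_eq hK,
      fieldBracket_eq hK hR.isGlobalChart (hasSmoothDifferential_mul_add_mul _ _ _)
        (hasSmoothDifferential_mul_add_mul _ _ _)]
    funext p
    simp only [smul_mul_assoc, mul_smul_comm, mul_add, add_mul, mul_sub, sub_mul, smul_add,
      smul_sub, mul_smul, mul_neg, mul_assoc]
    abel
  rw [ltsBracket, key, hR.transvectionField_eq hK,
    fieldBracket_eq hK hR.isGlobalChart (hasSmoothDifferential_mul_add_mul _ _ _)
        (hasSmoothDifferential_mul_add_mul _ _ _)]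
  -- The inner bracket vanishes at the identity, and the third field takes the full value `w` there,
  -- so no further half appears.
  simp only [Units.val_one, mul_one, one_mul, add_neg_cancel, mul_zero, zero_mul, add_zero,
    sub_zero, invOf_two_smul_add_invOf_two_smul]
  rw [mul_neg, ← sub_eq_add_neg, smul_mul_assoc, mul_smul_comm,
    ← smul_sub]

end UnitGroups

/-! ### Algebraic identities for the two products. -/

section Products

variable {R : Type u} [Ring R]

/-- The tangent map of `(g, h) ↦ g h⁻¹ g`. -/
def tangentMul (a b : Rˣ × R) : Rˣ × R :=
  (groupProduct a.1 b.1, a.2 * (b.1⁻¹).val * a.1 + a.1 * (b.1⁻¹).val * a.2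
    - a.1 * (b.1⁻¹).val * b.2 * (b.1⁻¹).val * a.1)

/-- The second symmetric bundle structure on the tangent bundle of the group of units. -/
def twistedMul (a b : Rˣ × R) : Rˣ × R :=
  (groupProduct a.1 b.1, a.2 + a.1 * (b.1⁻¹).val * a.2 * (b.1⁻¹).val * a.1
    - a.1 * (b.1⁻¹).val * b.2 * (b.1⁻¹).val * a.1)

theorem tangentMul_self (a : Rˣ × R) : tangentMul a a = a := by
  simp [tangentMul, groupProduct, mul_assoc]

theorem twistedMul_self (a : Rˣ × R) : twistedMul a a = a := by
  simp [twistedMul, groupProduct, mul_assoc]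

theorem tangentMul_tangentMul (a b : Rˣ × R) : tangentMul a (tangentMul a b) = b := by
  refine Prod.ext (by simp [tangentMul, groupProduct, mul_assoc]) ?_
  simp only [tangentMul, groupProduct, mul_inv_rev, inv_inv, Units.val_mul, mul_add, add_mul,
    mul_sub, sub_mul, mul_assoc, Units.mul_inv_cancel_left, Units.inv_mul_cancel_left,
    Units.inv_mul, mul_one]
  abel

theorem twistedMul_twistedMul (a b : Rˣ × R) : twistedMul a (twistedMul a b) = b := by
  refine Prod.ext (by simp [twistedMul, groupProduct, mul_assoc]) ?_
  simp only [twistedMul, groupProduct, mul_inv_rev, inv_inv, Units.val_mul, mul_add, add_mul,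
    mul_sub, sub_mul, mul_assoc, Units.mul_inv_cancel_left, Units.inv_mul_cancel_left,
    Units.inv_mul, mul_one]
  abel

theorem tangentMul_distrib (a b c : Rˣ × R) :
    tangentMul a (tangentMul b c) = tangentMul (tangentMul a b) (tangentMul a c) := by
  refine Prod.ext (by simp [tangentMul, groupProduct, mul_assoc]) ?_
  simp only [tangentMul, groupProduct, mul_inv_rev, inv_inv, Units.val_mul, mul_add, add_mul,
    mul_sub, sub_mul, mul_assoc, Units.mul_inv_cancel_left, Units.inv_mul_cancel_left]
  abel

theorem twistedMul_distrib (a b c : Rˣ × R) :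
    twistedMul a (twistedMul b c) = twistedMul (twistedMul a b) (twistedMul a c) := by
  refine Prod.ext (by simp [twistedMul, groupProduct, mul_assoc]) ?_
  simp only [twistedMul, groupProduct, mul_inv_rev, inv_inv, Units.val_mul, mul_add, add_mul,
    mul_sub, sub_mul, mul_assoc, Units.mul_inv_cancel_left, Units.inv_mul_cancel_left]
  abel

variable {K : Type u} [CommRing K] [Algebra K R]

theorem tangentMul_linear (p q : Rˣ) : ∃ A : R × R →ₗ[K] R, ∀ v w : R,
    (tangentMul (p, v) (q, w)).2 = A (v, w) := by
  let c (a b : R) : R →ₗ[K] R := LinearMap.mulLeft K a ∘ₗ LinearMap.mulRight K b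
  refine ⟨(c 1 ((q⁻¹).val * p) + c (p * (q⁻¹).val) 1) ∘ₗ LinearMap.fst K R R
    - c (p * (q⁻¹).val) ((q⁻¹).val * p) ∘ₗ LinearMap.snd K R R, fun v w => ?_⟩
  simp [tangentMul, c, mul_assoc]

theorem twistedMul_linear (p q : Rˣ) : ∃ A : R × R →ₗ[K] R, ∀ v w : R,
    (twistedMul (p, v) (q, w)).2 = A (v, w) := by
  let c (a b : R) : R →ₗ[K] R := LinearMap.mulLeft K a ∘ₗ LinearMap.mulRight K b
  refine ⟨(LinearMap.id + c (p * (q⁻¹).val) ((q⁻¹).val * p)) ∘ₗ LinearMap.fst K R R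
    - c (p * (q⁻¹).val) ((q⁻¹).val * p) ∘ₗ LinearMap.snd K R R, fun v w => ?_⟩
  simp [twistedMul, c, mul_assoc]

variable [Invertible (2 : K)]

/-- The contributions of the two half vectors cancel, so only the base point of `a` matters. The
companion `verticalSymmetry_twistedMul` has the same right-hand side, which is the equality of
reflection spaces. -/
theorem verticalSymmetry_tangentMul (a b : Rˣ × R) :
    verticalSymmetry K tangentMul a b
      = (groupProduct a.1 b.1, a.1 * (b.1⁻¹).val * b.2 * (b.1⁻¹).val * a.1) := by
  refine Prod.ext (by simp [verticalSymmetry, tangentMul, groupProduct, mul_assoc]) ?_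
  simp only [verticalSymmetry, tangentMul, groupProduct, mul_inv_rev, inv_inv, Units.val_mul,
    mul_add, add_mul, mul_zero, zero_mul, zero_sub, add_zero, neg_sub, mul_sub, sub_mul, mul_assoc, Units.mul_inv_cancel_left, Units.inv_mul_cancel_left,
    Units.mul_inv, Units.inv_mul, mul_one]
  abel

theorem verticalSymmetry_twistedMul (a b : Rˣ × R) :
    verticalSymmetry K twistedMul a b
      = (groupProduct a.1 b.1, a.1 * (b.1⁻¹).val * b.2 * (b.1⁻¹).val * a.1) := by
  refine Prod.ext (by simp [verticalSymmetry, twistedMul, groupProduct, mul_assoc]) ?_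
  simp only [verticalSymmetry, twistedMul, groupProduct, mul_inv_rev, inv_inv, Units.val_mul,
    mul_add, add_mul, mul_zero, zero_mul, zero_sub, add_zero, neg_sub, mul_sub, sub_mul, mul_assoc, Units.mul_inv_cancel_left, Units.inv_mul_cancel_left,
    Units.mul_inv, Units.inv_mul, mul_one]
  abel

end Products

/-! ### The two symmetric bundles, their transvection fields and representations. -/

section Bundles

variable {K : Type u} [CommRing K] [TopologicalSpace K] [IsTopologicalRing K]
  {R : Type u} [Ring R] [Algebra K R] [TopologicalSpace R] [IsTopologicalRing R]
  [ContinuousSMul K R]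

/-- The chart of the tangent bundle of the group of units. -/
abbrev unitsBundleChart (R : Type u) [Ring R] : Rˣ × R → R × R := bundleChart Units.val

/-- The explicit differential serves twice: for the axiom that symmetries have differential `-1` at
their centers, and for the transvection fields. -/
theorem HasContinuousInverse.hasSmoothDifferential_tangentMul (hR : HasContinuousInverse R) :
    HasSmoothDifferential K (Set.range (Prod.map (unitsBundleChart R) (unitsBundleChart R)))
      (fun z => (z.1.1 * Ring.inverse z.2.1 * z.1.1,
        z.1.2 * Ring.inverse z.2.1 * z.1.1 + z.1.1 * Ring.inverse z.2.1 * z.1.2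
          - z.1.1 * Ring.inverse z.2.1 * z.2.2 * Ring.inverse z.2.1 * z.1.1))
      (fun z v => (v.1.1 * Ring.inverse z.2.1 * z.1.1
          - z.1.1 * Ring.inverse z.2.1 * v.2.1 * Ring.inverse z.2.1 * z.1.1
          + z.1.1 * Ring.inverse z.2.1 * v.1.1,
        v.1.2 * Ring.inverse z.2.1 * z.1.1
          - z.1.2 * Ring.inverse z.2.1 * v.2.1 * Ring.inverse z.2.1 * z.1.1
          + z.1.2 * Ring.inverse z.2.1 * v.1.1
          + (v.1.1 * Ring.inverse z.2.1 * z.1.2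
          - z.1.1 * Ring.inverse z.2.1 * v.2.1 * Ring.inverse z.2.1 * z.1.2
          + z.1.1 * Ring.inverse z.2.1 * v.1.2)
          - (v.1.1 * Ring.inverse z.2.1 * z.2.2 * Ring.inverse z.2.1 * z.1.1
          - z.1.1 * Ring.inverse z.2.1 * v.2.1 * Ring.inverse z.2.1 * z.2.2 *
            Ring.inverse z.2.1 * z.1.1
          + z.1.1 * Ring.inverse z.2.1 * v.2.2 * Ring.inverse z.2.1 * z.1.1
          - z.1.1 * Ring.inverse z.2.1 * z.2.2 * Ring.inverse z.2.1 * v.2.1 *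
            Ring.inverse z.2.1 * z.1.1
          + z.1.1 * Ring.inverse z.2.1 * z.2.2 * Ring.inverse z.2.1 * v.1.1))) := by
  have h := HasSmoothDifferential.id (K := K)
    (Set.range (Prod.map (unitsBundleChart R) (unitsBundleChart R)))
  have m := h.fst.fst
  have V := h.fst.snd
  have W := h.snd.snd
  have i := h.snd.fst.inverse hR (by rintro _ ⟨a, rfl⟩; exact a.2.1.isUnit)
  refine (((m.mul i).mul m).prodMk ((((V.mul i).mul m).add ((m.mul i).mul V)).sub
    ((((m.mul i).mul W).mul i).mul m))).congr (fun _ _ => rfl) fun x _ v => Prod.ext ?_ ?_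
  · noncomm_ring
  · noncomm_ring

theorem HasContinuousInverse.hasSmoothDifferential_twistedMul (hR : HasContinuousInverse R) :
    HasSmoothDifferential K (Set.range (Prod.map (unitsBundleChart R) (unitsBundleChart R)))
      (fun z => (z.1.1 * Ring.inverse z.2.1 * z.1.1,
        z.1.2 + z.1.1 * Ring.inverse z.2.1 * z.1.2 * Ring.inverse z.2.1 * z.1.1
          - z.1.1 * Ring.inverse z.2.1 * z.2.2 * Ring.inverse z.2.1 * z.1.1))
      (fun z v => (v.1.1 * Ring.inverse z.2.1 * z.1.1
          - z.1.1 * Ring.inverse z.2.1 * v.2.1 * Ring.inverse z.2.1 * z.1.1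
          + z.1.1 * Ring.inverse z.2.1 * v.1.1,
        v.1.2 + (v.1.1 * Ring.inverse z.2.1 * z.1.2 * Ring.inverse z.2.1 * z.1.1
          - z.1.1 * Ring.inverse z.2.1 * v.2.1 * Ring.inverse z.2.1 * z.1.2 *
            Ring.inverse z.2.1 * z.1.1
          + z.1.1 * Ring.inverse z.2.1 * v.1.2 * Ring.inverse z.2.1 * z.1.1
          - z.1.1 * Ring.inverse z.2.1 * z.1.2 * Ring.inverse z.2.1 * v.2.1 *
            Ring.inverse z.2.1 * z.1.1
          + z.1.1 * Ring.inverse z.2.1 * z.1.2 * Ring.inverse z.2.1 * v.1.1)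
          - (v.1.1 * Ring.inverse z.2.1 * z.2.2 * Ring.inverse z.2.1 * z.1.1
          - z.1.1 * Ring.inverse z.2.1 * v.2.1 * Ring.inverse z.2.1 * z.2.2 *
            Ring.inverse z.2.1 * z.1.1
          + z.1.1 * Ring.inverse z.2.1 * v.2.2 * Ring.inverse z.2.1 * z.1.1
          - z.1.1 * Ring.inverse z.2.1 * z.2.2 * Ring.inverse z.2.1 * v.2.1 *
            Ring.inverse z.2.1 * z.1.1
          + z.1.1 * Ring.inverse z.2.1 * z.2.2 * Ring.inverse z.2.1 * v.1.1))) := by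
  have h := HasSmoothDifferential.id (K := K)
    (Set.range (Prod.map (unitsBundleChart R) (unitsBundleChart R)))
  have m := h.fst.fst
  have V := h.fst.snd
  have W := h.snd.snd
  have i := h.snd.fst.inverse hR (by rintro _ ⟨a, rfl⟩; exact a.2.1.isUnit)
  refine (((m.mul i).mul m).prodMk ((V.add ((((m.mul i).mul V).mul i).mul m)).sub
    ((((m.mul i).mul W).mul i).mul m))).congr (fun _ _ => rfl) fun x _ v => Prod.ext ?_ ?_
  · noncomm_ring
  · noncomm_ring

theorem HasContinuousInverse.isGlobalChart_bundle {R : Type u} [Ring R] [TopologicalSpace R]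
    (hR : HasContinuousInverse R) :
    IsGlobalChart (unitsBundleChart R) := hR.isGlobalChart.bundleChart

/-- The vector fields on `R × R` among which the transvection fields of both symmetric bundle
structures lie. -/
def bundleField (a b c d s t : R) (z : R × R) : R × R :=
  (a * z.1 + z.1 * b, s + c * z.1 + z.1 * d + z.1 * t * z.1 + (a * z.2 + z.2 * b))

theorem hasSmoothDifferential_bundleField (U : Set (R × R)) (a b c d s t : R) :
    HasSmoothDifferential K U (bundleField a b c d s t)
      (fun z v => (a * v.1 + v.1 * b,
        c * v.1 + v.1 * d + v.1 * t * z.1 + z.1 * t * v.1 + (a * v.2 + v.2 * b))) := by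
  have k := HasSmoothDifferential.const (K := K) (E := R × R) (F := R) U
  have p := (HasSmoothDifferential.id (K := K) U).fst
  have q := (HasSmoothDifferential.id (K := K) U).snd
  refine ((((k a).mul p).add (p.mul (k b))).prodMk (((((k s).add ((k c).mul p)).add
    (p.mul (k d))).add ((p.mul (k t)).mul p)).add (((k a).mul q).add (q.mul (k b))))).congr
    (fun _ _ => rfl) fun x _ v => Prod.ext ?_ ?_
  · noncomm_ring
  · noncomm_ring

variable [T2Space R]

theorem HasContinuousInverse.isSymmetricBundle_tangentMul (hK : Dense {x : K | IsUnit x})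
    (hR : HasContinuousInverse R) :
    IsSymmetricBundle K (Units.val : Rˣ → R) groupProduct tangentMul where
  base := hR.isSymmetricSpace hK
  total :=
    { chart := hR.isGlobalChart_bundle
      smooth := hR.hasSmoothDifferential_tangentMul.smoothMap
        (hR.isGlobalChart_bundle.prodMap hR.isGlobalChart_bundle).1
        (by rintro ⟨a, b⟩; simp [bundleChart, tangentMul, groupProduct])
      idem := tangentMul_self
      invol := tangentMul_tangentMul
      distrib := tangentMul_distrib
      differential := fun x v => by
        have h := ((HasSmoothDifferential.const (K := K) (Set.range (unitsBundleChart R))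
          (unitsBundleChart R x)).prodMk (HasSmoothDifferential.id _))
        have h' := hR.hasSmoothDifferential_tangentMul.comp h
          (by rintro _ ⟨y, rfl⟩; exact ⟨(x, y), rfl⟩)
        rw [h'.tangentMap_eq hK hR.isGlobalChart_bundle
          (by intro a; simp [bundleChart, tangentMul, groupProduct])]
        refine Prod.ext ?_ ?_
        · simp [bundleChart]
        · simp [bundleChart, mul_assoc]
          abel }
  proj _ _ := rfl
  fiber_linear := tangentMul_linear

theorem HasContinuousInverse.isSymmetricBundle_twistedMul (hK : Dense {x : K | IsUnit x})
    (hR : HasContinuousInverse R) :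
    IsSymmetricBundle K (Units.val : Rˣ → R) groupProduct twistedMul where
  base := hR.isSymmetricSpace hK
  total :=
    { chart := hR.isGlobalChart_bundle
      smooth := hR.hasSmoothDifferential_twistedMul.smoothMap
        (hR.isGlobalChart_bundle.prodMap hR.isGlobalChart_bundle).1
        (by rintro ⟨a, b⟩; simp [bundleChart, twistedMul, groupProduct])
      idem := twistedMul_self
      invol := twistedMul_twistedMul
      distrib := twistedMul_distrib
      differential := fun x v => by
        have h := ((HasSmoothDifferential.const (K := K) (Set.range (unitsBundleChart R))
          (unitsBundleChart R x)).prodMk (HasSmoothDifferential.id _))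
        have h' := hR.hasSmoothDifferential_twistedMul.comp h
          (by rintro _ ⟨y, rfl⟩; exact ⟨(x, y), rfl⟩)
        rw [h'.tangentMap_eq hK hR.isGlobalChart_bundle
          (by intro a; simp [bundleChart, twistedMul, groupProduct])]
        refine Prod.ext ?_ ?_
        · simp [bundleChart]
        · simp [bundleChart, mul_assoc] }
  proj _ _ := rfl
  fiber_linear := twistedMul_linear

theorem HasContinuousInverse.tangentProduct_eq (hK : Dense {x : K | IsUnit x})
    (hR : HasContinuousInverse R) :
    tangentProduct K (Units.val : Rˣ → R) groupProduct = tangentMul := by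
  funext a b
  exact Prod.ext rfl (hR.tangentMap_groupProduct hK (a.1, b.1) (a.2, b.2))

section Transvections

variable [Invertible (2 : K)]

theorem HasContinuousInverse.transvectionField_tangentMul (hK : Dense {x : K | IsUnit x})
    (hR : HasContinuousInverse R) (x w : R) :
    transvectionField K (unitsBundleChart R) tangentMul (1, 0) (x, w)
      = fun p => bundleField (⅟(2 : K) • x) (⅟(2 : K) • x) (⅟(2 : K) • w) (⅟(2 : K) • w) 0 0
        (unitsBundleChart R p) := by
  funext p
  have h := fun p v => hR.hasSmoothDifferential_tangentMul.tangentMap_eq hK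
    (f := Function.uncurry tangentMul) (ψ := unitsBundleChart R)
    (hR.isGlobalChart_bundle.prodMap hR.isGlobalChart_bundle)
    (by rintro ⟨a, b⟩; simp [bundleChart, tangentMul, groupProduct]) p v
  simp only [transvectionField, tangentProduct, h]
  refine Prod.ext ?_ ?_
  · simp [bundleChart, tangentMul, groupProduct, bundleField]
  · simp [bundleChart, tangentMul, groupProduct, bundleField, mul_assoc]
    abel

/-- Here the structures part: the vertical vector `w` generates `(w + p w p)/2`, whereas for
`tangentMul` it generates `(w p + p w)/2`. Base vectors generate the same fields. -/
theorem HasContinuousInverse.transvectionField_twistedMul (hK : Dense {x : K | IsUnit x})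
    (hR : HasContinuousInverse R) (x w : R) :
    transvectionField K (unitsBundleChart R) twistedMul (1, 0) (x, w)
      = fun p => bundleField (⅟(2 : K) • x) (⅟(2 : K) • x) 0 0 (⅟(2 : K) • w) (⅟(2 : K) • w)
        (unitsBundleChart R p) := by
  funext p
  have h := fun p v => hR.hasSmoothDifferential_twistedMul.tangentMap_eq hK
    (f := Function.uncurry twistedMul) (ψ := unitsBundleChart R)
    (hR.isGlobalChart_bundle.prodMap hR.isGlobalChart_bundle)
    (by rintro ⟨a, b⟩; simp [bundleChart, twistedMul, groupProduct]) p v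
  simp only [transvectionField, tangentProduct, h]
  refine Prod.ext ?_ ?_
  · simp [bundleChart, twistedMul, groupProduct, bundleField]
  · simp [bundleChart, twistedMul, groupProduct, bundleField, mul_assoc]
    abel

end Transvections

theorem HasContinuousInverse.fieldBracket_bundleField (hK : Dense {x : K | IsUnit x})
    (hR : HasContinuousInverse R) (a b c d s t a' b' c' d' s' t' : R) :
    fieldBracket K (unitsBundleChart R) (fun p => bundleField a b c d s t (unitsBundleChart R p))
      (fun p => bundleField a' b' c' d' s' t' (unitsBundleChart R p)) = fun p =>
      ((fun z v : R × R => (a * v.1 + v.1 * b,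
        c * v.1 + v.1 * d + v.1 * t * z.1 + z.1 * t * v.1 + (a * v.2 + v.2 * b)))
          (unitsBundleChart R p) (bundleField a' b' c' d' s' t' (unitsBundleChart R p)) -
        (fun z v : R × R => (a' * v.1 + v.1 * b',
        c' * v.1 + v.1 * d' + v.1 * t' * z.1 + z.1 * t' * v.1 + (a' * v.2 + v.2 * b')))
          (unitsBundleChart R p) (bundleField a b c d s t (unitsBundleChart R p))) :=
  fieldBracket_eq hK hR.isGlobalChart_bundle (hasSmoothDifferential_bundleField _ _ _ _ _ _ _)
    (hasSmoothDifferential_bundleField _ _ _ _ _ _ _)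

/-- The bracket of two transvection fields with parameters in the base. -/
theorem HasContinuousInverse.fieldBracket_bundleField_base (hK : Dense {x : K | IsUnit x})
    (hR : HasContinuousInverse R) (a b : R) :
    fieldBracket K (unitsBundleChart R) (fun p => bundleField a a 0 0 0 0 (unitsBundleChart R p))
      (fun p => bundleField b b 0 0 0 0 (unitsBundleChart R p)) = fun p =>
      bundleField (a * b - b * a) (-(a * b - b * a)) 0 0 0 0 (unitsBundleChart R p) := by
  rw [hR.fieldBracket_bundleField hK]
  funext p
  refine Prod.ext ?_ ?_ <;> simp only [bundleField, Prod.fst_sub, Prod.snd_sub] <;> noncomm_ring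

theorem HasContinuousInverse.fieldBracket_bundleField_tangent (hK : Dense {x : K | IsUnit x})
    (hR : HasContinuousInverse R) (a c : R) :
    fieldBracket K (unitsBundleChart R) (fun p => bundleField a a 0 0 0 0 (unitsBundleChart R p))
      (fun p => bundleField 0 0 c c 0 0 (unitsBundleChart R p)) = fun p =>
      bundleField 0 0 (a * c - c * a) (-(a * c - c * a)) 0 0 (unitsBundleChart R p) := by
  rw [hR.fieldBracket_bundleField hK]
  funext p
  refine Prod.ext ?_ ?_ <;> simp only [bundleField, Prod.fst_sub, Prod.snd_sub] <;> noncomm_ring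

/-- Differentiating `s + p s p` along `a p + p a` leaves, after the outer terms cancel, `{a, s} - p
{a, s} p`: an anticommutator, where the usual structure gives a commutator. -/
theorem HasContinuousInverse.fieldBracket_bundleField_twisted (hK : Dense {x : K | IsUnit x})
    (hR : HasContinuousInverse R) (a s : R) :
    fieldBracket K (unitsBundleChart R) (fun p => bundleField a a 0 0 0 0 (unitsBundleChart R p))
      (fun p => bundleField 0 0 0 0 s s (unitsBundleChart R p)) = fun p =>
      bundleField 0 0 0 0 (a * s + s * a) (-(a * s + s * a)) (unitsBundleChart R p) := by
  rw [hR.fieldBracket_bundleField hK]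
  funext p
  refine Prod.ext ?_ ?_ <;> simp only [bundleField, Prod.fst_sub, Prod.snd_sub] <;> noncomm_ring

variable [Invertible (2 : K)]

theorem HasContinuousInverse.bundleR_tangentMul (hK : Dense {x : K | IsUnit x})
    (hR : HasContinuousInverse R) (x y w : R) :
    bundleR K (Units.val : Rˣ → R) tangentMul 1 x y w
      = (⅟(2 : K) * ⅟(2 : K)) • ((x * y - y * x) * w - w * (x * y - y * x)) := by
  rw [bundleR, ltsBracket]
  simp only [hR.transvectionField_tangentMul hK, smul_zero, hR.fieldBracket_bundleField_base hK,
    hR.fieldBracket_bundleField hK]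
  simp [bundleField, bundleChart, mul_smul, smul_sub]
  simp only [sub_mul, mul_sub, smul_sub, smul_mul_assoc,
    mul_smul_comm, mul_assoc]
  abel

theorem HasContinuousInverse.bundleR_twistedMul (hK : Dense {x : K | IsUnit x})
    (hR : HasContinuousInverse R) (x y w : R) :
    bundleR K (Units.val : Rˣ → R) twistedMul 1 x y w
      = (⅟(2 : K) * ⅟(2 : K)) • ((x * y - y * x) * w - w * (x * y - y * x)) := by
  rw [bundleR, ltsBracket]
  simp only [hR.transvectionField_twistedMul hK, smul_zero, hR.fieldBracket_bundleField_base hK,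
    hR.fieldBracket_bundleField hK]
  simp [bundleField, bundleChart, mul_smul, smul_sub]
  simp only [sub_mul, mul_sub, smul_sub, smul_mul_assoc,
    mul_smul_comm, mul_assoc]
  abel

theorem HasContinuousInverse.bundleM_tangentMul (hK : Dense {x : K | IsUnit x})
    (hR : HasContinuousInverse R) (x z w : R) :
    bundleM K (Units.val : Rˣ → R) tangentMul 1 x z w
      = (⅟(2 : K) * ⅟(2 : K)) • ((x * w - w * x) * z - z * (x * w - w * x)) := by
  rw [bundleM, ltsBracket]
  simp only [hR.transvectionField_tangentMul hK, smul_zero, hR.fieldBracket_bundleField_tangent hK,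
    hR.fieldBracket_bundleField hK]
  simp [bundleField, bundleChart, mul_smul, smul_sub]
  simp only [sub_mul, mul_sub, smul_sub, smul_mul_assoc,
    mul_smul_comm, mul_assoc]
  abel

/-- The inner bracket is `s - p s p` with `s = {x, w}/4`. It vanishes at the base point, and its
differential there in direction `z` is `-(z s + s z)`, whence the sign. -/
theorem HasContinuousInverse.bundleM_twistedMul (hK : Dense {x : K | IsUnit x})
    (hR : HasContinuousInverse R) (x z w : R) :
    bundleM K (Units.val : Rˣ → R) twistedMul 1 x z w
      = -((⅟(2 : K) * ⅟(2 : K)) • ((x * w + w * x) * z + z * (x * w + w * x))) := by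
  rw [bundleM, ltsBracket]
  simp only [hR.transvectionField_twistedMul hK, smul_zero, hR.fieldBracket_bundleField_twisted hK,
    hR.fieldBracket_bundleField hK]
  simp [bundleField, bundleChart, mul_smul]
  simp only [add_mul, mul_add, smul_add, smul_mul_assoc,
    mul_smul_comm, mul_neg, neg_mul, mul_assoc]
  abel

end Bundles

/-! ### Triple commutators and anticommutators in an associative algebra. -/

section Algebra

variable {K : Type u} [CommRing K] {R : Type u} [Ring R] [Algebra K R]

/-- The triple commutator `c [[x, y], z]`. -/
def tripleCommutator (c : K) (x y z : R) : R :=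
  c • ((x * y - y * x) * z - z * (x * y - y * x))

/-- The negative triple anticommutator `-c {{x, w}, z}`. -/
def tripleAnticommutator (c : K) (x z w : R) : R :=
  -(c • ((x * w + w * x) * z + z * (x * w + w * x)))

theorem tripleCommutator_trilinear (c : K) :
    ∃ T : R →ₗ[K] R →ₗ[K] Module.End K R, ∀ x y z, T x y z = tripleCommutator c x y z := by
  refine ⟨LinearMap.mk₂ K (fun x y => c • (LinearMap.mulLeft K (x * y - y * x)
    - LinearMap.mulRight K (x * y - y * x))) ?_ ?_ ?_ ?_, fun x y z => rfl⟩
  all_goals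
    intros
    ext
    simp only [LinearMap.smul_apply, LinearMap.sub_apply, LinearMap.add_apply,
      LinearMap.mulLeft_apply, LinearMap.mulRight_apply, sub_mul, mul_sub, add_mul, mul_add,
      smul_sub, smul_add, smul_mul_assoc, mul_smul_comm, smul_smul, mul_comm c]
    try abel

theorem tripleAnticommutator_trilinear (c : K) :
    ∃ T : R →ₗ[K] R →ₗ[K] Module.End K R, ∀ x y z, T x y z = tripleAnticommutator c x y z := by
  refine ⟨LinearMap.mk₂ K (fun x z => -(c •
    ((LinearMap.mulRight K z + LinearMap.mulLeft K z) ∘ₗ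
      (LinearMap.mulLeft K x + LinearMap.mulRight K x)))) ?_ ?_ ?_ ?_,
    fun x y z => rfl⟩
  all_goals
    intros
    ext
    simp only [LinearMap.smul_apply, LinearMap.neg_apply, LinearMap.add_apply,
      LinearMap.comp_apply,
      LinearMap.mulLeft_apply, LinearMap.mulRight_apply, add_mul, mul_add,
      smul_add, smul_mul_assoc, mul_smul_comm, smul_smul, mul_comm c, smul_neg]
    try abel

/-- Bracketing with `[x, y]` is an inner derivation of the associative algebra, hence a derivation
of anything built from its product. -/
theorem tripleCommutator_derivation (c : K) (x y a b z : R) :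
    tripleCommutator c x y (tripleCommutator c a b z)
      = tripleCommutator c (tripleCommutator c x y a) b z
        + tripleCommutator c a (tripleCommutator c x y b) z
        + tripleCommutator c a b (tripleCommutator c x y z) := by
  simp only [tripleCommutator, smul_mul_assoc, mul_smul_comm, ← smul_sub, ← smul_add]
  -- Both sides carry the factor `c` twice; what remains is an identity without scalars.
  congr 2
  noncomm_ring

theorem isLieTripleSystem_tripleCommutator (c : K) :
    IsLieTripleSystem K (tripleCommutator (R := R) c) where
  trilinear := tripleCommutator_trilinear c
  skew x y z := by
    rw [tripleCommutator, tripleCommutator, ← smul_neg]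
    congr 1
    noncomm_ring
  jacobi x y z := by
    rw [tripleCommutator, tripleCommutator, tripleCommutator, ← smul_add, ← smul_add]
    convert smul_zero c
    noncomm_ring
  derivation x y a b z := tripleCommutator_derivation c x y a b z

/-- The operators `r` are inner derivations and so respect anticommutators, and `{{z, w}, x} - {{x,
w}, z} = [[x, z], w]` links `m` to `r`. The remaining law is also an identity of associative
polynomials. -/
theorem isLtsModule_tripleAnticommutator (c : K) :
    IsLtsModule K (tripleCommutator (R := R) c) (tripleCommutator c)
      (tripleAnticommutator c) where
  r_linear := tripleCommutator_trilinear c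
  m_linear := tripleAnticommutator_trilinear c
  r_skew := (isLieTripleSystem_tripleCommutator c).skew
  m_sub x z w := by
    simp only [tripleCommutator, tripleAnticommutator, ← smul_neg, ← smul_sub]
    congr 1
    noncomm_ring
  r_deriv x y a b w := by
    rw [tripleCommutator_derivation c x y a b w]
    abel
  m_deriv x y a b w := by
    simp only [tripleCommutator, tripleAnticommutator, smul_mul_assoc, mul_smul_comm, ← smul_sub,
      ← smul_add, ← smul_neg, mul_neg, neg_mul]
    congr 2
    noncomm_ring
  m_bracket x a b d w := by
    simp only [tripleCommutator, tripleAnticommutator, smul_mul_assoc, mul_smul_comm, ← smul_sub,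
      ← smul_add, ← smul_neg, mul_neg, neg_mul]
    congr 2
    noncomm_ring

/-- Test on the identity element: it is central, so the adjoint `m(1, 1)` is zero, while the
anticommutator version sends `1` to `-1`. Intertwining `m` alone is already impossible. -/
theorem not_ltsModuleEquivalent [Nontrivial R] [Invertible (2 : K)] :
    ¬ LtsModuleEquivalent K (tripleCommutator (R := R) (⅟(2 : K) * ⅟(2 : K)))
      (tripleAnticommutator (⅟(2 : K) * ⅟(2 : K)))
      (adjointR (tripleCommutator (R := R) (⅟(2 : K) * ⅟(2 : K))))
      (adjointM (tripleCommutator (R := R) (⅟(2 : K) * ⅟(2 : K)))) := by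
  rintro ⟨A, -, hA⟩
  have h := hA 1 1 1
  have h1 : tripleAnticommutator (⅟(2 : K) * ⅟(2 : K)) (1 : R) 1 1 = -1 := by
    simp only [tripleAnticommutator, mul_one, one_mul, mul_smul]
    rw [smul_add, invOf_two_smul_add_invOf_two_smul, smul_add, invOf_two_smul_add_invOf_two_smul]
  have h2 : ∀ a : R, adjointM (tripleCommutator (⅟(2 : K) * ⅟(2 : K))) 1 1 a = 0 := fun a => by
    simp [adjointM, tripleCommutator]
  rw [h1, h2, map_neg, neg_eq_zero, map_eq_zero_iff _ A.injective] at h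
  exact one_ne_zero h

end Algebra

/-! ### The two symmetric bundles are not isomorphic. -/

section NotIsomorphic

variable {K : Type u} [CommRing K] [TopologicalSpace K] [IsTopologicalRing K]
  {R : Type u} [Ring R] [Nontrivial R] [Algebra K R] [TopologicalSpace R] [IsTopologicalRing R]
  [ContinuousSMul K R] [T2Space R]

/-- The usual product obeys `2 (p, 0)(1, 1) = -(1, 1)(p⁻², 0)` in the fiber over `p²`. Transported
to the twisted product, with `f p` a scalar multiple `t` of `f 1`, the two sides acquire the factors
`-2 t²` and `-(1 + t⁴)`. -/
theorem not_isSymmetricBundleIso (hK : Dense {x : K | IsUnit x}) :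
    ¬ ∃ f e, IsSymmetricBundleIso K (Units.val : Rˣ → R) groupProduct tangentMul twistedMul
      f e := by
  rintro ⟨f, e, he⟩
  have hfp : ∀ p q, f (groupProduct p q) = groupProduct (f p) (f q) := he.base.map_mul
  choose A hA using he.fiber_linear
  have heq : ∀ p w, e (p, w) = (f p, A p w) := fun p w => Prod.ext (he.proj (p, w)) (hA p w)
  have hinj : ∀ w, A 1 w = 0 → w = 0 := fun w hw => by
    have : e (1, w) = e (1, 0) := by rw [heq, heq, hw, map_zero]
    exact congrArg Prod.snd (e.injective this)
  have key : ∀ t : Kˣ, (1 - (t : K) * t) ^ 2 • (1 : R) = 0 := by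
    intro t
    let T : Rˣ := Units.map (algebraMap K R).toMonoidHom t
    -- The automorphism `f` of the base is arbitrary, so the point is chosen through its image;
    -- centrality of `T` makes all products below computable.
    obtain ⟨p, hp⟩ := f.surjective (T * f 1)
    have hT : ∀ a : R, T.val * a = (t : K) • a := fun a => (Algebra.smul_def _ _).symm
    have hTc : ∀ a : R, T.val * a = a * T.val := fun a => Algebra.commutes _ _
    have hTu : ∀ g : Rˣ, g * T = T * g := fun g => Units.ext (hTc g).symm
    have hTTu : ∀ g : Rˣ, g * (T * T) = T * T * g := fun g => by
      rw [← mul_assoc, hTu, mul_assoc, hTu, ← mul_assoc]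
    have hTT : ∀ a : R, ((T * T : Rˣ) : R) * a * ((T * T : Rˣ) : R)
        = ((t : K) * t * (t * t)) • a := fun a => by
      simp only [Units.val_mul, mul_assoc]
      rw [← mul_assoc a, ← hTc a, mul_assoc, ← hTc a]
      simp only [hT, smul_smul]
    have hp1 : f p * (f 1)⁻¹ = T := by rw [hp, mul_inv_cancel_right]
    have hp2 : (f 1)⁻¹ * f p = T := by rw [hp, ← mul_assoc, hTu, inv_mul_cancel_right]
    have hpp : f (p * p) = T * T * f 1 := by
      have := hfp p 1
      simp only [groupProduct, inv_one, mul_one] at this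
      rw [this, hp1, hp, mul_assoc]
    have hq : (f (p * p)⁻¹)⁻¹ = T * T * (f 1)⁻¹ := by
      have := hfp 1 (p * p)
      simp only [groupProduct, one_mul, mul_one] at this
      rw [this, hpp, mul_inv_rev, mul_inv_rev (f 1), inv_inv, mul_inv_cancel_right, hTTu]
    have hq1 : f 1 * (f (p * p)⁻¹)⁻¹ = T * T := by
      rw [hq, ← mul_assoc, hTTu, mul_inv_cancel_right]
    have hq2 : (f (p * p)⁻¹)⁻¹ * f 1 = T * T := by rw [hq, inv_mul_cancel_right]
    have e1 := congrArg Prod.snd (he.total.map_mul (p, 0) (1, 1))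
    have e2 := congrArg Prod.snd (he.total.map_mul (1, 1) ((p * p)⁻¹, 0))
    have t1 : tangentMul (p, 0) (1, (1 : R)) = (p * p, -((p * p : Rˣ) : R)) := by
      simp [tangentMul, groupProduct]
    have t2 : tangentMul (1, 1) ((p * p)⁻¹, (0 : R))
        = (p * p, ((p * p : Rˣ) : R) + ((p * p : Rˣ) : R)) := by
      simp [tangentMul, groupProduct]
    rw [t1, heq, heq, heq] at e1
    rw [t2, heq, heq, heq] at e2
    simp only [twistedMul, map_zero, map_neg, map_add, mul_zero, zero_mul, add_zero, sub_zero,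
      zero_sub, neg_inj, ← Units.val_mul, hp1, hq1] at e1 e2
    rw [mul_assoc, ← Units.val_mul, hp2, hT, ← hTc, hT] at e1
    -- Now `e2` equates `t² A + t² A` with `A + t⁴ A`, where `A` is the image of the vector `1` over
    -- the identity.
    rw [mul_assoc, ← Units.val_mul, hq2, hTT, e1] at e2
    refine hinj _ ?_
    have hpoly : (1 - (t : K) * t) ^ 2 = 1 + t * t * (t * t) - (t * t + t * t) := by ring
    rw [map_smul, hpoly, sub_smul, add_smul, add_smul, one_smul, ← e2, mul_smul, sub_self]
  -- The relation is a closed condition valid on the dense set of units, so it also holds at `t =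
  -- 0`, where it says `1 = 0`.
  have hcl : IsClosed {t : K | (1 - t * t) ^ 2 • (1 : R) = 0} :=
    isClosed_eq (by fun_prop) continuous_const
  have h0 : (0 : K) ∈ {t : K | (1 - t * t) ^ 2 • (1 : R) = 0} :=
    hcl.closure_subset_iff.mpr (fun t ht => by obtain ⟨t, rfl⟩ := ht; exact key t) (hK 0)
  simp at h0

end NotIsomorphic

/-! ### Degenerate matrix coordinates and the homogeneous space. -/

/-- Coordinates on an algebra `S` that identify it with the matrices `(p, x; y, q)` over `R`,
multiplied as if all products of off-diagonal entries were zero. -/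
structure DegenerateCoordinates (K R S : Type u) [CommRing K] [Ring R] [Algebra K R]
    [TopologicalSpace R] [Ring S] [Algebra K S] [TopologicalSpace S] where
  P : S →L[K] R
  X : S →L[K] R
  Y : S →L[K] R
  Q : S →L[K] R
  ofCoords : R × R × R × R →L[K] S
  P_ofCoords : ∀ z, P (ofCoords z) = z.1
  X_ofCoords : ∀ z, X (ofCoords z) = z.2.1
  Y_ofCoords : ∀ z, Y (ofCoords z) = z.2.2.1
  Q_ofCoords : ∀ z, Q (ofCoords z) = z.2.2.2
  ofCoords_coords : ∀ s, ofCoords (P s, X s, Y s, Q s) = s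
  P_one : P 1 = 1
  X_one : X 1 = 0
  Y_one : Y 1 = 0
  Q_one : Q 1 = 1
  P_mul : ∀ s t, P (s * t) = P s * P t
  X_mul : ∀ s t, X (s * t) = P s * X t + X s * Q t
  Y_mul : ∀ s t, Y (s * t) = Y s * P t + Q s * Y t
  Q_mul : ∀ s t, Q (s * t) = Q s * Q t

namespace DegenerateCoordinates

variable {K R S : Type u} [CommRing K] [Ring R] [Algebra K R]
  [TopologicalSpace R] [Ring S] [Algebra K S] [TopologicalSpace S]
  (C : DegenerateCoordinates K R S)

theorem ext {s t : S} (hP : C.P s = C.P t) (hX : C.X s = C.X t) (hY : C.Y s = C.Y t)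
    (hQ : C.Q s = C.Q t) : s = t := by
  rw [← C.ofCoords_coords s, ← C.ofCoords_coords t, hP, hX, hY, hQ]

/-- The first diagonal entry of a unit. -/
def unitP : Sˣ →* Rˣ := Units.map ⟨⟨C.P, C.P_one⟩, C.P_mul⟩

/-- The second diagonal entry of a unit. -/
def unitQ : Sˣ →* Rˣ := Units.map ⟨⟨C.Q, C.Q_one⟩, C.Q_mul⟩

theorem val_unitP (g : Sˣ) : (C.unitP g).val = C.P g := rfl

theorem val_unitQ (g : Sˣ) : (C.unitQ g).val = C.Q g := rfl

/-- The unit with given coordinates. -/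
def mkUnit (p q : Rˣ) (x y : R) : Sˣ where
  val := C.ofCoords (p, x, y, q)
  inv := C.ofCoords ((p⁻¹).val, -((p⁻¹).val * x * (q⁻¹).val), -((q⁻¹).val * y * (p⁻¹).val), (q⁻¹).val)
  val_inv := C.ext (by simp [C.P_mul, C.P_ofCoords, C.P_one])
    (by simp [C.X_mul, C.P_ofCoords, C.X_ofCoords, C.Q_ofCoords, C.X_one, mul_assoc])
    (by simp [C.Y_mul, C.P_ofCoords, C.Y_ofCoords, C.Q_ofCoords, C.Y_one, mul_assoc])
    (by simp [C.Q_mul, C.Q_ofCoords, C.Q_one])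
  inv_val := C.ext (by simp [C.P_mul, C.P_ofCoords, C.P_one])
    (by simp [C.X_mul, C.P_ofCoords, C.X_ofCoords, C.Q_ofCoords, C.X_one, mul_assoc])
    (by simp [C.Y_mul, C.P_ofCoords, C.Y_ofCoords, C.Q_ofCoords, C.Y_one, mul_assoc])
    (by simp [C.Q_mul, C.Q_ofCoords, C.Q_one])

theorem val_mkUnit (p q : Rˣ) (x y : R) : (C.mkUnit p q x y).val = C.ofCoords (p, x, y, q) := rfl

theorem unitP_mkUnit (p q : Rˣ) (x y : R) : C.unitP (C.mkUnit p q x y) = p :=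
  Units.ext (C.P_ofCoords _)

theorem unitQ_mkUnit (p q : Rˣ) (x y : R) : C.unitQ (C.mkUnit p q x y) = q :=
  Units.ext (C.Q_ofCoords _)

theorem eq_mkUnit (g : Sˣ) : g = C.mkUnit (C.unitP g) (C.unitQ g) (C.X g) (C.Y g) :=
  Units.ext (C.ofCoords_coords g).symm

theorem X_inv (g : Sˣ) :
    C.X (g⁻¹).val = -(((C.unitP g)⁻¹).val * C.X g * ((C.unitQ g)⁻¹).val) := by
  conv_lhs => rw [C.eq_mkUnit g]
  exact C.X_ofCoords _

theorem Y_inv (g : Sˣ) :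
    C.Y (g⁻¹).val = -(((C.unitQ g)⁻¹).val * C.Y g * ((C.unitP g)⁻¹).val) := by
  conv_lhs => rw [C.eq_mkUnit g]
  exact C.Y_ofCoords _

/-- The off-diagonal elements form an ideal of square zero, so they do not affect invertibility. -/
theorem isUnit_iff (s : S) : IsUnit s ↔ IsUnit (C.P s) ∧ IsUnit (C.Q s) := by
  constructor
  · rintro ⟨g, rfl⟩
    exact ⟨(C.unitP g).isUnit, (C.unitQ g).isUnit⟩
  · rintro ⟨⟨p, hp⟩, ⟨q, hq⟩⟩
    refine ⟨C.mkUnit p q (C.X s) (C.Y s), ?_⟩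
    rw [val_mkUnit, hp, hq, C.ofCoords_coords]

theorem hasContinuousInverse (C : DegenerateCoordinates K R S) [IsTopologicalRing R] (hR : HasContinuousInverse R) :
    HasContinuousInverse S where
  isOpen := by
    have : {x : S | IsUnit x} = C.P ⁻¹' {x | IsUnit x} ∩ C.Q ⁻¹' {x | IsUnit x} :=
      Set.ext C.isUnit_iff
    rw [this]
    exact (hR.isOpen.preimage C.P.continuous).inter (hR.isOpen.preimage C.Q.continuous)
  continuousOn := by
    have hP : ContinuousOn (fun s => Ring.inverse (C.P s)) {x : S | IsUnit x} :=
      hR.continuousOn.comp C.P.continuous.continuousOn (fun s hs => ((C.isUnit_iff s).1 hs).1)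
    have hQ : ContinuousOn (fun s => Ring.inverse (C.Q s)) {x : S | IsUnit x} :=
      hR.continuousOn.comp C.Q.continuous.continuousOn (fun s hs => ((C.isUnit_iff s).1 hs).2)
    have hX := C.X.continuous.continuousOn (s := {x : S | IsUnit x})
    have hY := C.Y.continuous.continuousOn (s := {x : S | IsUnit x})
    refine (C.ofCoords.continuous.comp_continuousOn (hP.prodMk (((hP.mul hX).mul hQ).neg.prodMk
      (((hQ.mul hY).mul hP).neg.prodMk hQ)))).congr ?_
    rintro _ ⟨g, rfl⟩
    rw [Ring.inverse_unit]
    conv_lhs => rw [C.eq_mkUnit g]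
    simp only [Function.comp_apply, Pi.neg_apply, Pi.mul_apply, ← C.val_unitP, ← C.val_unitQ, Ring.inverse_unit]
    rfl

/-- The projection of the group of units to the tangent bundle. -/
def toBundle (g : Sˣ) : Rˣ × R :=
  (C.unitP g * (C.unitQ g)⁻¹,
    (C.X g - C.unitP g * ((C.unitQ g)⁻¹).val * C.Y g) * ((C.unitQ g)⁻¹).val)

/-- A section of the projection to the tangent bundle. -/
def ofBundle (a : Rˣ × R) : Sˣ := C.mkUnit a.1 1 a.2 0

theorem toBundle_ofBundle (a : Rˣ × R) : C.toBundle (C.ofBundle a) = a := by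
  simp [toBundle, ofBundle, unitP_mkUnit, unitQ_mkUnit, val_mkUnit, C.X_ofCoords, C.Y_ofCoords]

theorem toBundle_one : C.toBundle 1 = (1, 0) := by
  simp [toBundle, C.X_one, C.Y_one]

/-- The projection to the tangent bundle is equivariant for the diagonal units. -/
theorem toBundle_diagonal_mul {d : Sˣ} (hX : C.X d = 0) (hY : C.Y d = 0) (g : Sˣ) :
    C.toBundle (d * g) = (C.unitP d * (C.toBundle g).1 * (C.unitQ d)⁻¹,
      C.unitP d * (C.toBundle g).2 * ((C.unitQ d)⁻¹).val) := by
  refine Prod.ext (by simp [toBundle, mul_assoc]) ?_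
  simp [toBundle, C.X_mul, C.Y_mul, hX, hY, ← C.val_unitP, ← C.val_unitQ, mul_sub, sub_mul,
    mul_assoc]

/-- The involution `σ` of the group of units exchanges the diagonal entries, and the
off-diagonal ones. -/
structure IsSwap (σ : Sˣ →* Sˣ) : Prop where
  P : ∀ g, C.P (σ g) = C.Q g
  X : ∀ g, C.X (σ g) = C.Y g
  Y : ∀ g, C.Y (σ g) = C.X g
  Q : ∀ g, C.Q (σ g) = C.P g

variable {C} {σ : Sˣ →* Sˣ}

theorem IsSwap.unitP (hσ : C.IsSwap σ) (g : Sˣ) : C.unitP (σ g) = C.unitQ g := Units.ext (hσ.P g)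

theorem IsSwap.unitQ (hσ : C.IsSwap σ) (g : Sˣ) : C.unitQ (σ g) = C.unitP g := Units.ext (hσ.Q g)

/-- This computation is the source of the formula for `twistedMul`. -/
theorem IsSwap.toBundle_mul (hσ : C.IsSwap σ) (g g' : Sˣ) :
    C.toBundle (g * (σ g)⁻¹ * σ g') = twistedMul (C.toBundle g) (C.toBundle g') := by
  refine Prod.ext (by simp [toBundle, twistedMul, groupProduct, hσ.unitP, hσ.unitQ, mul_assoc]) ?_
  simp only [toBundle, twistedMul, map_mul, map_inv, hσ.unitP, hσ.unitQ, Units.val_mul, C.X_mul,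
    C.Y_mul, C.P_mul, C.Q_mul, C.X_inv, C.Y_inv, hσ.X, hσ.Y, ← C.val_unitP, ← C.val_unitQ,
    mul_inv_rev, inv_inv, mul_add, add_mul, mul_sub, sub_mul, mul_neg, neg_mul, mul_assoc,
    Units.mul_inv_cancel_left, Units.inv_mul_cancel_left]
  abel

/-- Shows that `g σ(g)⁻¹` depends only on `toBundle g`; conversely its coordinates `a` and `V a⁻¹`
determine `(a, V)`. -/
theorem IsSwap.mul_inv_eq (hσ : C.IsSwap σ) (g : Sˣ) :
    g * (σ g)⁻¹ = C.mkUnit (C.toBundle g).1 ((C.toBundle g).1)⁻¹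
      ((C.toBundle g).2 * ((C.toBundle g).1⁻¹).val)
      (-(((C.toBundle g).1⁻¹).val * (C.toBundle g).2)) := by
  refine Units.ext (C.ext ?_ ?_ ?_ ?_)
  · rw [← C.val_unitP, ← C.val_unitP, C.unitP_mkUnit, map_mul, map_inv, hσ.unitP]; rfl
  · rw [C.val_mkUnit, C.X_ofCoords]
    simp [toBundle, C.X_mul, C.X_inv, hσ.unitP, hσ.unitQ, hσ.X, ← C.val_unitP, ← C.val_unitQ,
      mul_assoc, sub_mul]
    abel
  · rw [C.val_mkUnit, C.Y_ofCoords]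
    simp [toBundle, C.Y_mul, C.Y_inv, hσ.unitP, hσ.unitQ, hσ.Y, ← C.val_unitP, ← C.val_unitQ,
      mul_assoc, sub_mul, mul_sub]
    abel
  · rw [← C.val_unitQ, ← C.val_unitQ, C.unitQ_mkUnit, map_mul, map_inv, hσ.unitQ]
    simp [toBundle]

/-- By `mul_inv_eq` the fibers are those of `g ↦ g σ(g)⁻¹`, which are the left cosets of the fixed
group. -/
theorem IsSwap.toBundle_eq_iff (hσ : C.IsSwap σ) (g g' : Sˣ) :
    C.toBundle g = C.toBundle g' ↔ σ (g⁻¹ * g') = g⁻¹ * g' := by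
  have h1 : C.toBundle g = C.toBundle g' ↔ g * (σ g)⁻¹ = g' * (σ g')⁻¹ := by
    constructor
    · intro h
      rw [hσ.mul_inv_eq, hσ.mul_inv_eq, h]
    · intro h
      rw [hσ.mul_inv_eq, hσ.mul_inv_eq] at h
      have hm := congrArg C.unitP h
      rw [C.unitP_mkUnit, C.unitP_mkUnit] at hm
      have hV := congrArg (fun u : Sˣ => C.X u) h
      simp only [C.val_mkUnit, C.X_ofCoords, hm] at hV
      exact Prod.ext hm (by simpa using hV)
  rw [h1, map_mul, map_inv, eq_mul_inv_iff_mul_eq, mul_assoc, ← eq_inv_mul_iff_mul_eq]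

variable {H : Subgroup Sˣ}

theorem IsSwap.toBundle_eq_iff_mem (hσ : C.IsSwap σ)
    (hH : ∀ g, g ∈ H ↔ σ g = g) (g g' : Sˣ) :
    C.toBundle g = C.toBundle g' ↔ g⁻¹ * g' ∈ H := by
  rw [hσ.toBundle_eq_iff, hH]

/-- The identification of the homogeneous space with the tangent bundle. -/
noncomputable def IsSwap.quotientEquiv (hσ : C.IsSwap σ)
    (hH : ∀ g, g ∈ H ↔ σ g = g) : Sˣ ⧸ H ≃ Rˣ × R :=
  Equiv.ofBijective
    (Quotient.lift C.toBundle fun a b h =>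
      (hσ.toBundle_eq_iff_mem hH a b).2 (QuotientGroup.leftRel_apply.1 h))
    ⟨by
      rintro ⟨a⟩ ⟨b⟩ h
      exact QuotientGroup.eq.2 ((hσ.toBundle_eq_iff_mem hH a b).1 h),
    fun a => ⟨(C.ofBundle a : Sˣ ⧸ H), C.toBundle_ofBundle a⟩⟩

theorem IsSwap.quotientEquiv_mk (hσ : C.IsSwap σ)
    (hH : ∀ g, g ∈ H ↔ σ g = g) (g : Sˣ) :
    hσ.quotientEquiv hH (g : Sˣ ⧸ H) = C.toBundle g := rfl

section Topology

variable [TopologicalSpace K] [IsTopologicalRing K] [IsTopologicalRing R] [ContinuousSMul K R]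
  [IsTopologicalRing S] [ContinuousSMul K S]

theorem smoothMap_toBundle (C : DegenerateCoordinates K R S) (hR : HasContinuousInverse R) :
    SmoothMap K (Units.val : Sˣ → S) (unitsBundleChart R) C.toBundle := by
  have h (A : S →L[K] R) :=
    HasSmoothDifferential.continuousLinearMap (Set.range (Units.val : Sˣ → S)) A
  have hQ := (h C.Q).inverse hR (by rintro _ ⟨g, rfl⟩; exact (C.unitQ g).isUnit)
  refine (((h C.P).mul hQ).prodMk (((h C.X).sub (((h C.P).mul hQ).mul (h C.Y))).mul
    hQ)).smoothMap Units.val_injective fun g => ?_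
  simp [← C.val_unitP, ← C.val_unitQ, bundleChart, toBundle]

theorem IsSwap.isHomogeneousRealization (hσ : C.IsSwap σ) (hH : ∀ g, g ∈ H ↔ σ g = g)
    (hR : HasContinuousInverse R) :
    IsHomogeneousRealization K (Units.val : Sˣ → S) σ H (unitsBundleChart R) twistedMul
      (hσ.quotientEquiv hH) where
  submersion :=
    { smooth := C.smoothMap_toBundle hR
      localSection := fun g => by
        have hmem : (C.ofBundle (C.toBundle g))⁻¹ * g ∈ H :=
          (hσ.toBundle_eq_iff_mem hH _ _).1 (C.toBundle_ofBundle _)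
        -- The global section `ofBundle`, multiplied on the right by the element of `H` that carries
        -- its value over `toBundle g` to `g`.
        refine ⟨Set.univ, isOpen_univ, Set.mem_univ _,
          fun a => C.ofBundle a * ((C.ofBundle (C.toBundle g))⁻¹ * g),
          mul_inv_cancel_left _ _, fun a _ => ?_, ?_⟩
        · rw [hσ.quotientEquiv_mk, ← (hσ.toBundle_eq_iff_mem hH (C.ofBundle a) _).2
            (by rwa [inv_mul_cancel_left]), C.toBundle_ofBundle]
        · rw [Set.univ_inter]
          have h := HasSmoothDifferential.id (K := K) (Set.range (unitsBundleChart R))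
          have k := fun r : R => HasSmoothDifferential.const (K := K)
            (Set.range (unitsBundleChart R)) r
          refine (((h.fst.prodMk (h.snd.prodMk ((k 0).prodMk (k 1)))).map C.ofCoords).mul
            (HasSmoothDifferential.const _
              ((C.ofBundle (C.toBundle g))⁻¹ * g).val)).smoothMap
            hR.isGlobalChart_bundle.1 fun a => ?_
          rw [Units.val_mul]
          rfl }
  map_mul := hσ.toBundle_mul

end Topology

end DegenerateCoordinates

/-! ### Matrices over a continuous inverse ring. -/

section MatrixInverse

/-- Cramer's rule: invertibility is read off the determinant, and the inverse is the adjugate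
divided by it. -/
theorem HasContinuousInverse.matrix {K : Type u} [CommRing K] [TopologicalSpace K]
    [IsTopologicalRing K] (hK : HasContinuousInverse K) (n : ℕ) :
    HasContinuousInverse (Matrix (Fin n) (Fin n) K) where
  isOpen := by
    simp only [Matrix.isUnit_iff_isUnit_det]
    exact hK.isOpen.preimage (Continuous.matrix_det continuous_id)
  continuousOn := by
    have h : ContinuousOn (fun A : Matrix (Fin n) (Fin n) K => Ring.inverse A.det)
        {A | IsUnit A} :=
      hK.continuousOn.comp (Continuous.matrix_det continuous_id).continuousOn
        (fun A hA => (Matrix.isUnit_iff_isUnit_det A).1 hA)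
    refine (h.smul (Continuous.matrix_adjugate continuous_id).continuousOn).congr fun A _ => ?_
    rw [← Matrix.nonsing_inv_eq_ringInverse, Matrix.inv_def]
    rfl

end MatrixInverse

/-! ### Coordinates of degenerate quaternions. -/

section Coordinates

variable (K : Type u) [CommRing K]

/-- The coordinate of the degenerate quaternion `(a, b)` at the idempotent `(1, -1) / 2`. -/
noncomputable def quatP : DegenerateQuaternion K →ₗ[K] K where
  toFun u := (u.val 0 0).fst - (u.val 0 1).fst
  map_add' u v := by simp; ring
  map_smul' c u := by simp [mul_sub]

/-- The coordinate of a degenerate quaternion at the idempotent `(1, 1) / 2`. -/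
noncomputable def quatQ : DegenerateQuaternion K →ₗ[K] K where
  toFun u := (u.val 0 0).fst + (u.val 0 1).fst
  map_add' u v := by simp; ring
  map_smul' c u := by simp [mul_add]

/-- The first nilpotent coordinate of a degenerate quaternion. -/
noncomputable def quatX : DegenerateQuaternion K →ₗ[K] K where
  toFun u := (u.val 0 0).snd + (u.val 0 1).snd
  map_add' u v := by simp; ring
  map_smul' c u := by simp [mul_add]

/-- The second nilpotent coordinate of a degenerate quaternion. -/
noncomputable def quatY : DegenerateQuaternion K →ₗ[K] K where
  toFun u := (u.val 0 0).snd - (u.val 0 1).snd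
  map_add' u v := by simp; ring
  map_smul' c u := by simp [mul_sub]

/-- The degenerate quaternion with given coordinates. -/
noncomputable def quatOfCoords [Invertible (2 : K)] : K × K × K × K →ₗ[K] DegenerateQuaternion K where
  toFun z := ⟨quatMatrix K
    (TrivSqZeroExt.inl (⅟2 * (z.1 + z.2.2.2)) + TrivSqZeroExt.inr (⅟2 * (z.2.1 + z.2.2.1)))
    (TrivSqZeroExt.inl (⅟2 * (z.2.2.2 - z.1)) + TrivSqZeroExt.inr (⅟2 * (z.2.1 - z.2.2.1))),
    _, _, rfl⟩
  map_add' z w := by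
    refine Subtype.ext (Matrix.ext fun i j => TrivSqZeroExt.ext ?_ ?_) <;> fin_cases i <;>
      fin_cases j <;> simp [quatMatrix, dualConj] <;> ring
  map_smul' c z := by
    refine Subtype.ext (Matrix.ext fun i j => TrivSqZeroExt.ext ?_ ?_) <;> fin_cases i <;>
      fin_cases j <;> simp [quatMatrix, dualConj] <;> ring

variable {K}

theorem exists_eq_quatMatrix (u : DegenerateQuaternion K) :
    ∃ a b : DualNumber K, u.val = quatMatrix K a b := u.2

theorem quatP_apply {u : DegenerateQuaternion K} {a b : DualNumber K}
    (h : u.val = quatMatrix K a b) : quatP K u = a.fst - b.fst := by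
  change (u.val 0 0).fst - (u.val 0 1).fst = _
  rw [h]
  rfl

theorem quatQ_apply {u : DegenerateQuaternion K} {a b : DualNumber K}
    (h : u.val = quatMatrix K a b) : quatQ K u = a.fst + b.fst := by
  change (u.val 0 0).fst + (u.val 0 1).fst = _
  rw [h]
  rfl

theorem quatX_apply {u : DegenerateQuaternion K} {a b : DualNumber K}
    (h : u.val = quatMatrix K a b) : quatX K u = a.snd + b.snd := by
  change (u.val 0 0).snd + (u.val 0 1).snd = _
  rw [h]
  rfl

theorem quatY_apply {u : DegenerateQuaternion K} {a b : DualNumber K}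
    (h : u.val = quatMatrix K a b) : quatY K u = a.snd - b.snd := by
  change (u.val 0 0).snd - (u.val 0 1).snd = _
  rw [h]
  rfl

theorem quatMatrix_mul (a b c d : DualNumber K) :
    quatMatrix K a b * quatMatrix K c d
      = quatMatrix K (a * c + b * dualConj K d) (a * d + b * dualConj K c) := by
  simp only [quatMatrix, Matrix.mul_fin_two, map_add, map_mul, dualConj_dualConj]
  congr! 3
  all_goals ring_nf

/-- Conjugation changes the sign of the `ε`-part, so `ε` moves one idempotent into the other and the
`ε`-parts sit off the diagonal; `ε² = 0` kills their products. -/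
theorem quat_mul_coords (u v : DegenerateQuaternion K) :
    quatP K (u * v) = quatP K u * quatP K v ∧
    quatX K (u * v) = quatP K u * quatX K v + quatX K u * quatQ K v ∧
    quatY K (u * v) = quatY K u * quatP K v + quatQ K u * quatY K v ∧
    quatQ K (u * v) = quatQ K u * quatQ K v := by
  obtain ⟨a, b, hu⟩ := exists_eq_quatMatrix u
  obtain ⟨c, d, hv⟩ := exists_eq_quatMatrix v
  have huv : (u * v).val
      = quatMatrix K (a * c + b * dualConj K d) (a * d + b * dualConj K c) := by
    rw [MulMemClass.coe_mul, hu, hv, quatMatrix_mul]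
  rw [quatP_apply hu, quatQ_apply hu, quatX_apply hu, quatY_apply hu, quatP_apply hv,
    quatQ_apply hv, quatX_apply hv, quatY_apply hv, quatP_apply huv, quatQ_apply huv,
    quatX_apply huv, quatY_apply huv]
  simp [dualConj]
  refine ⟨by ring, by ring, by ring, by ring⟩

/-- The involution replaces `b` by `-b`, and the coordinates are the sums and differences of the
parts of `a` and `b`. -/
theorem quatInvolution_coords (u : DegenerateQuaternion K) :
    quatP K (quatInvolution K u) = quatQ K u ∧ quatX K (quatInvolution K u) = quatY K u ∧
    quatY K (quatInvolution K u) = quatX K u ∧ quatQ K (quatInvolution K u) = quatP K u := by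
  obtain ⟨a, b, hu⟩ := exists_eq_quatMatrix u
  have h : (quatInvolution K u).val = quatMatrix K a (-b) := by
    change !![1, 0; 0, -1] * u.val * !![1, 0; 0, -1] = _
    rw [hu]
    refine Matrix.ext fun i j => ?_
    fin_cases i <;> fin_cases j <;> simp [quatMatrix]
  rw [quatP_apply hu, quatQ_apply hu, quatX_apply hu, quatY_apply hu, quatP_apply h,
    quatQ_apply h, quatX_apply h, quatY_apply h]
  simp [sub_eq_add_neg]

theorem quat_one_coords : quatP K 1 = 1 ∧ quatX K 1 = 0 ∧ quatY K 1 = 0 ∧ quatQ K 1 = 1 := by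
  have h : (1 : DegenerateQuaternion K).val = quatMatrix K 1 0 := by
    simp [quatMatrix, Matrix.one_fin_two]
  rw [quatP_apply h, quatQ_apply h, quatX_apply h, quatY_apply h]
  simp

theorem diagEmbedding_injective : Function.Injective (diagEmbedding K) := fun a b h => by
  have := congrFun (congrFun (congrArg Subtype.val h) 0) 0
  exact this

variable [Invertible (2 : K)]

theorem quatOfCoords_coords (u : DegenerateQuaternion K) :
    quatOfCoords K (quatP K u, quatX K u, quatY K u, quatQ K u) = u := by
  obtain ⟨a, b, hu⟩ := exists_eq_quatMatrix u
  refine Subtype.ext ?_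
  rw [hu]
  have h2 : (⅟2 : K) * 2 = 1 := invOf_mul_self 2
  change quatMatrix K _ _ = _
  simp only [quatP_apply hu, quatQ_apply hu, quatX_apply hu, quatY_apply hu]
  congr 1
  · refine TrivSqZeroExt.ext ?_ ?_ <;> simp
    · linear_combination a.fst * h2
    · linear_combination a.snd * h2
  · refine TrivSqZeroExt.ext ?_ ?_ <;> simp
    · linear_combination b.fst * h2
    · linear_combination b.snd * h2

theorem coords_quatOfCoords (z : K × K × K × K) :
    quatP K (quatOfCoords K z) = z.1 ∧ quatX K (quatOfCoords K z) = z.2.1 ∧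
    quatY K (quatOfCoords K z) = z.2.2.1 ∧ quatQ K (quatOfCoords K z) = z.2.2.2 := by
  have h2 : (⅟2 : K) * 2 = 1 := invOf_mul_self 2
  have h : (quatOfCoords K z).val = quatMatrix K _ _ := rfl
  rw [quatP_apply h, quatQ_apply h, quatX_apply h, quatY_apply h]
  simp
  refine ⟨?_, ?_, ?_, ?_⟩
  · linear_combination z.1 * h2
  · linear_combination z.2.1 * h2
  · linear_combination z.2.2.1 * h2
  · linear_combination z.2.2.2 * h2

theorem pairEmbedding_coords (s : K × K) :
    quatP K (pairEmbedding K s) = s.1 ∧ quatX K (pairEmbedding K s) = 0 ∧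
    quatY K (pairEmbedding K s) = 0 ∧ quatQ K (pairEmbedding K s) = s.2 := by
  have h2 : (⅟2 : K) * 2 = 1 := invOf_mul_self 2
  have h : (pairEmbedding K s).val = quatMatrix K (TrivSqZeroExt.inl (⅟2 * (s.1 + s.2)))
        (TrivSqZeroExt.inl (⅟2 * (s.2 - s.1))) := rfl
  rw [quatP_apply h, quatQ_apply h, quatX_apply h, quatY_apply h]
  simp
  refine ⟨?_, ?_⟩
  · linear_combination s.1 * h2
  · linear_combination s.2 * h2

/-- The fixed points of the involution are the diagonal matrices. -/
theorem quatInvolution_eq_self_iff (u : DegenerateQuaternion K) :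
    quatInvolution K u = u ↔ ∃ a, diagEmbedding K a = u := by
  obtain ⟨a, b, hu⟩ := exists_eq_quatMatrix u
  obtain ⟨h1, h2, h3, h4⟩ := quatInvolution_coords u
  constructor
  · intro h
    rw [h, quatP_apply hu, quatQ_apply hu] at h1
    rw [h, quatX_apply hu, quatY_apply hu] at h2
    have hh : (⅟2 : K) * 2 = 1 := invOf_mul_self 2
    have hb : b = 0 := by
      refine TrivSqZeroExt.ext ?_ ?_
      · rw [TrivSqZeroExt.fst_zero]
        linear_combination -⅟2 * h1 - b.fst * hh
      · rw [TrivSqZeroExt.snd_zero]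
        linear_combination ⅟2 * h2 - b.snd * hh
    refine ⟨a, Subtype.ext ?_⟩
    rw [hu, hb]
    rfl
  · rintro ⟨a, rfl⟩
    refine Subtype.ext ?_
    change !![1, 0; 0, -1] * quatMatrix K a 0 * !![1, 0; 0, -1] = quatMatrix K a 0
    refine Matrix.ext fun i j => ?_
    fin_cases i <;> fin_cases j <;> simp [quatMatrix]

end Coordinates

/-! ### Continuity of the coordinates and their extension to matrices. -/

section Topology

variable {K : Type u} [CommRing K] [TopologicalSpace K]

theorem continuous_quat_entry (i j : Fin 2) :
    Continuous fun u : DegenerateQuaternion K => u.val i j :=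
  continuous_subtype_val.matrix_elem i j

variable [IsTopologicalRing K]

instance : IsTopologicalRing (DegenerateQuaternion K) :=
  inferInstanceAs (IsTopologicalRing (DegenerateQuaternion K).toSubring)

theorem continuous_quatP : Continuous (quatP K) :=
  (TrivSqZeroExt.continuous_fst.comp (continuous_quat_entry 0 0)).sub
    (TrivSqZeroExt.continuous_fst.comp (continuous_quat_entry 0 1))

theorem continuous_quatQ : Continuous (quatQ K) :=
  (TrivSqZeroExt.continuous_fst.comp (continuous_quat_entry 0 0)).add
    (TrivSqZeroExt.continuous_fst.comp (continuous_quat_entry 0 1))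

theorem continuous_quatX : Continuous (quatX K) :=
  (TrivSqZeroExt.continuous_snd.comp (continuous_quat_entry 0 0)).add
    (TrivSqZeroExt.continuous_snd.comp (continuous_quat_entry 0 1))

theorem continuous_quatY : Continuous (quatY K) :=
  (TrivSqZeroExt.continuous_snd.comp (continuous_quat_entry 0 0)).sub
    (TrivSqZeroExt.continuous_snd.comp (continuous_quat_entry 0 1))

theorem continuous_dualConj : Continuous (dualConj K) := by
  have h : ∀ a : DualNumber K, dualConj K a = TrivSqZeroExt.inl a.fst + TrivSqZeroExt.inr (-a.snd) :=
    fun a => by refine TrivSqZeroExt.ext ?_ ?_ <;> simp [dualConj]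
  rw [funext h]
  exact (TrivSqZeroExt.continuous_inl.comp TrivSqZeroExt.continuous_fst).add
    (TrivSqZeroExt.continuous_inr.comp TrivSqZeroExt.continuous_snd.neg)

theorem continuous_quatOfCoords [Invertible (2 : K)] : Continuous (quatOfCoords K) := by
  have ha : Continuous fun z : K × K × K × K =>
      (TrivSqZeroExt.inl (⅟2 * (z.1 + z.2.2.2)) + TrivSqZeroExt.inr (⅟2 * (z.2.1 + z.2.2.1)) :
        DualNumber K) :=
    (TrivSqZeroExt.continuous_inl.comp (by fun_prop)).add
      (TrivSqZeroExt.continuous_inr.comp (by fun_prop))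
  have hb : Continuous fun z : K × K × K × K =>
      (TrivSqZeroExt.inl (⅟2 * (z.2.2.2 - z.1)) + TrivSqZeroExt.inr (⅟2 * (z.2.1 - z.2.2.1)) :
        DualNumber K) :=
    (TrivSqZeroExt.continuous_inl.comp (by fun_prop)).add
      (TrivSqZeroExt.continuous_inr.comp (by fun_prop))
  refine Continuous.subtype_mk (continuous_matrix fun i j => ?_) _
  fin_cases i <;> fin_cases j
  exacts [ha, hb, continuous_dualConj.comp hb, continuous_dualConj.comp ha]

/-- The entrywise extension of a continuous linear map to matrices. -/
noncomputable def matrixMapCLM {K V W : Type u} [CommRing K] [AddCommGroup V] [Module K V] [TopologicalSpace V]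
    [AddCommGroup W] [Module K W] [TopologicalSpace W] (n : ℕ) (A : V →ₗ[K] W)
    (hA : Continuous A) : Matrix (Fin n) (Fin n) V →L[K] Matrix (Fin n) (Fin n) W where
  toLinearMap := A.mapMatrix
  cont := Continuous.matrix_map continuous_id hA

theorem matrixMapCLM_apply {K V W : Type u} [CommRing K] [AddCommGroup V] [Module K V] [TopologicalSpace V]
    [AddCommGroup W] [Module K W] [TopologicalSpace W] (n : ℕ) (A : V →ₗ[K] W)
    (hA : Continuous A) (M : Matrix (Fin n) (Fin n) V) (i j : Fin n) :
    matrixMapCLM n A hA M i j = A (M i j) := rfl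

variable [Invertible (2 : K)]

/-- The coordinates of matrices of degenerate quaternions. -/
noncomputable def matrixQuatCoordinates (n : ℕ) : DegenerateCoordinates K
    (Matrix (Fin n) (Fin n) K) (Matrix (Fin n) (Fin n) (DegenerateQuaternion K)) where
  P := matrixMapCLM n (quatP K) continuous_quatP
  X := matrixMapCLM n (quatX K) continuous_quatX
  Y := matrixMapCLM n (quatY K) continuous_quatY
  Q := matrixMapCLM n (quatQ K) continuous_quatQ
  ofCoords :=
    { toFun := fun z => Matrix.of fun i j =>
        quatOfCoords K (z.1 i j, z.2.1 i j, z.2.2.1 i j, z.2.2.2 i j)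
      map_add' := fun z w => Matrix.ext fun i j => (quatOfCoords K).map_add
        (z.1 i j, z.2.1 i j, z.2.2.1 i j, z.2.2.2 i j) (w.1 i j, w.2.1 i j, w.2.2.1 i j, w.2.2.2 i j)
      map_smul' := fun c z => Matrix.ext fun i j => (quatOfCoords K).map_smul c
        (z.1 i j, z.2.1 i j, z.2.2.1 i j, z.2.2.2 i j)
      cont := continuous_matrix fun i j => continuous_quatOfCoords.comp
        ((continuous_fst.matrix_elem i j).prodMk ((continuous_snd.fst.matrix_elem i j).prodMk
          ((continuous_snd.snd.fst.matrix_elem i j).prodMk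
            (continuous_snd.snd.snd.matrix_elem i j)))) }
  P_ofCoords z := Matrix.ext fun i j => (coords_quatOfCoords _).1
  X_ofCoords z := Matrix.ext fun i j => (coords_quatOfCoords _).2.1
  Y_ofCoords z := Matrix.ext fun i j => (coords_quatOfCoords _).2.2.1
  Q_ofCoords z := Matrix.ext fun i j => (coords_quatOfCoords _).2.2.2
  ofCoords_coords s := Matrix.ext fun i j => quatOfCoords_coords (s i j)
  P_one := Matrix.ext fun i j => by
    simp [matrixMapCLM_apply, Matrix.one_apply, apply_ite (quatP K), quat_one_coords]
  X_one := Matrix.ext fun i j => by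
    simp [matrixMapCLM_apply, Matrix.one_apply, apply_ite (quatX K), quat_one_coords]
  Y_one := Matrix.ext fun i j => by
    simp [matrixMapCLM_apply, Matrix.one_apply, apply_ite (quatY K), quat_one_coords]
  Q_one := Matrix.ext fun i j => by
    simp [matrixMapCLM_apply, Matrix.one_apply, apply_ite (quatQ K), quat_one_coords]
  P_mul s t := Matrix.ext fun i j => by
    simp only [matrixMapCLM_apply, Matrix.mul_apply, map_sum, (quat_mul_coords _ _).1]
  X_mul s t := Matrix.ext fun i j => by
    simp only [matrixMapCLM_apply, Matrix.mul_apply, Matrix.add_apply, map_sum,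
      (quat_mul_coords _ _).2.1, Finset.sum_add_distrib]
  Y_mul s t := Matrix.ext fun i j => by
    simp only [matrixMapCLM_apply, Matrix.mul_apply, Matrix.add_apply, map_sum,
      (quat_mul_coords _ _).2.2.1, Finset.sum_add_distrib]
  Q_mul s t := Matrix.ext fun i j => by
    simp only [matrixMapCLM_apply, Matrix.mul_apply, map_sum, (quat_mul_coords _ _).2.2.2]

theorem isSwap_glInvolution (n : ℕ) : (matrixQuatCoordinates n).IsSwap (glInvolution K n) where
  P g := Matrix.ext fun i j => (quatInvolution_coords (g.val i j)).1
  X g := Matrix.ext fun i j => (quatInvolution_coords (g.val i j)).2.1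
  Y g := Matrix.ext fun i j => (quatInvolution_coords (g.val i j)).2.2.1
  Q g := Matrix.ext fun i j => (quatInvolution_coords (g.val i j)).2.2.2

/-- The embedded pairs are the diagonal units `(g, 0; 0, h)`, which puts them within reach of
`toBundle_diagonal_mul`. -/
theorem glPair_coords (n : ℕ) (g h : GLn n K) :
    (matrixQuatCoordinates n).unitP (glPair K n g h) = g ∧
    (matrixQuatCoordinates n).X (glPair K n g h) = (0 : Matrix (Fin n) (Fin n) K) ∧
    (matrixQuatCoordinates n).Y (glPair K n g h) = (0 : Matrix (Fin n) (Fin n) K) ∧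
    (matrixQuatCoordinates n).unitQ (glPair K n g h) = h :=
  ⟨Units.ext (Matrix.ext fun i j => (pairEmbedding_coords (g.val i j, h.val i j)).1),
    Matrix.ext fun i j => (pairEmbedding_coords (g.val i j, h.val i j)).2.1,
    Matrix.ext fun i j => (pairEmbedding_coords (g.val i j, h.val i j)).2.2.1,
    Units.ext (Matrix.ext fun i j => (pairEmbedding_coords (g.val i j, h.val i j)).2.2.2)⟩

end Topology

/-! ### The fixed group of the involution. -/

section FixedPoints

variable {K : Type u} [CommRing K] (n : ℕ)

theorem glInvolution_glInvolution (g : GLn n (DegenerateQuaternion K)) :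
    glInvolution K n (glInvolution K n g) = g := by
  refine Units.ext (Matrix.ext fun i j => Subtype.ext ?_)
  have h : (!![1, 0; 0, -1] : Matrix (Fin 2) (Fin 2) (DualNumber K)) * !![1, 0; 0, -1] = 1 := by
    simp [Matrix.one_fin_two]
  change !![1, 0; 0, -1] * (!![1, 0; 0, -1] * (g.val i j).val * !![1, 0; 0, -1]) *
    !![1, 0; 0, -1] = (g.val i j).val
  rw [mul_assoc, mul_assoc, mul_assoc, h, mul_one, ← mul_assoc, h, one_mul]

variable [Invertible (2 : K)]

theorem exists_diagEmbedding_mapMatrix (A : Matrix (Fin n) (Fin n) (DegenerateQuaternion K))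
    (hA : (quatInvolution K).mapMatrix A = A) : ∃ B, (diagEmbedding K).mapMatrix B = A := by
  have h : ∀ i j, ∃ a, diagEmbedding K a = A i j := fun i j =>
    (quatInvolution_eq_self_iff _).1 (congrFun (congrFun hA i) j)
  choose B hB using h
  exact ⟨Matrix.of B, Matrix.ext hB⟩

theorem mem_glDual_iff (g : GLn n (DegenerateQuaternion K)) :
    g ∈ glDual K n ↔ glInvolution K n g = g := by
  constructor
  · rintro ⟨b, rfl⟩
    exact Units.ext (Matrix.ext fun i j => (quatInvolution_eq_self_iff _).2 ⟨b.val i j, rfl⟩)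
  · intro hg
    obtain ⟨B, hB⟩ := exists_diagEmbedding_mapMatrix n g.val (congrArg Units.val hg)
    -- The inverse must be diagonal as well, so that the preimage of `g` is invertible over the dual
    -- numbers.
    have hg' : glInvolution K n g⁻¹ = g⁻¹ := by rw [map_inv, hg]
    obtain ⟨C, hC⟩ := exists_diagEmbedding_mapMatrix n (g⁻¹).val (congrArg Units.val hg')
    have hinj : Function.Injective ((diagEmbedding K).mapMatrix (m := Fin n)) := fun A A' h =>
      Matrix.ext fun i j => diagEmbedding_injective (congrFun (congrFun h i) j)
    exact ⟨⟨B, C, hinj (by rw [map_mul, hB, hC, Units.mul_inv, map_one]),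
      hinj (by rw [map_mul, hB, hC, Units.inv_mul, map_one])⟩, Units.ext hB⟩

end FixedPoints

/-! ### The usual structure as a linear group over the dual numbers. -/

section DualNumbers

variable {K : Type u} [CommRing K] {n : ℕ}

theorem map_fst_mul (A B : Matrix (Fin n) (Fin n) (DualNumber K)) :
    (A * B).map TrivSqZeroExt.fst = A.map TrivSqZeroExt.fst * B.map TrivSqZeroExt.fst := by
  ext i j
  simp [Matrix.mul_apply, TrivSqZeroExt.fst_sum]

theorem map_snd_mul (A B : Matrix (Fin n) (Fin n) (DualNumber K)) :
    (A * B).map TrivSqZeroExt.snd = A.map TrivSqZeroExt.fst * B.map TrivSqZeroExt.snd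
      + A.map TrivSqZeroExt.snd * B.map TrivSqZeroExt.fst := by
  ext i j
  simp [Matrix.mul_apply, TrivSqZeroExt.snd_sum, Finset.sum_add_distrib, mul_comm]

theorem dualMatrix_ext {A B : Matrix (Fin n) (Fin n) (DualNumber K)}
    (h : A.map TrivSqZeroExt.fst = B.map TrivSqZeroExt.fst)
    (h' : A.map TrivSqZeroExt.snd = B.map TrivSqZeroExt.snd) : A = B :=
  Matrix.ext fun i j => TrivSqZeroExt.ext (congrFun (congrFun h i) j) (congrFun (congrFun h' i) j)

/-- The matrix `A + ε B`. -/
def dualMatrix (A B : Matrix (Fin n) (Fin n) K) : Matrix (Fin n) (Fin n) (DualNumber K) :=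
  A.map TrivSqZeroExt.inl + B.map TrivSqZeroExt.inr

theorem map_fst_dualMatrix (A B : Matrix (Fin n) (Fin n) K) :
    (dualMatrix A B).map TrivSqZeroExt.fst = A := by ext; simp [dualMatrix]

theorem map_snd_dualMatrix (A B : Matrix (Fin n) (Fin n) K) :
    (dualMatrix A B).map TrivSqZeroExt.snd = B := by ext; simp [dualMatrix]

theorem dualMatrix_mul (A B C D : Matrix (Fin n) (Fin n) K) :
    dualMatrix A B * dualMatrix C D = dualMatrix (A * C) (A * D + B * C) :=
  dualMatrix_ext (by simp only [map_fst_mul, map_fst_dualMatrix])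
    (by simp only [map_snd_mul, map_fst_dualMatrix, map_snd_dualMatrix])

theorem dualMatrix_one_zero : dualMatrix (1 : Matrix (Fin n) (Fin n) K) 0 = 1 :=
  dualMatrix_ext (by rw [map_fst_dualMatrix]; ext i j; by_cases h : i = j <;> simp [Matrix.one_apply, h])
    (by
      rw [map_snd_dualMatrix]
      ext i j
      by_cases h : i = j <;> simp [h])

/-- The identification of `T GL(n, K)` with `GL(n, K[ε])`. -/
def dualEquiv (K : Type u) [CommRing K] (n : ℕ) : TGL K n ≃ GLn n (DualNumber K) where
  toFun a :=
    { val := dualMatrix a.1.val a.2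
      inv := dualMatrix (a.1⁻¹).val (-((a.1⁻¹).val * a.2 * (a.1⁻¹).val))
      val_inv := by
        rw [dualMatrix_mul, ← dualMatrix_one_zero]
        simp [mul_assoc]
      inv_val := by
        rw [dualMatrix_mul, ← dualMatrix_one_zero]
        simp [mul_assoc] }
  invFun u := (Units.map (TrivSqZeroExt.fstHom K K K).mapMatrix.toRingHom.toMonoidHom u,
    u.val.map TrivSqZeroExt.snd)
  left_inv a := Prod.ext (Units.ext (map_fst_dualMatrix _ _)) (map_snd_dualMatrix _ _)
  right_inv u := Units.ext (dualMatrix_ext (map_fst_dualMatrix _ _) (map_snd_dualMatrix _ _))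

theorem val_dualEquiv (a : TGL K n) : (dualEquiv K n a).val = dualMatrix a.1.val a.2 := rfl

theorem val_inv_dualEquiv (a : TGL K n) : ((dualEquiv K n a)⁻¹).val
    = dualMatrix (a.1⁻¹).val (-((a.1⁻¹).val * a.2 * (a.1⁻¹).val)) := rfl

/-- Because `(b + ε W)⁻¹ = b⁻¹ - ε b⁻¹ W b⁻¹`, the `ε`-part of the product over the dual numbers is
the differential of `(a, b) ↦ a b⁻¹ a`. -/
theorem dualEquiv_tangentMul (a b : TGL K n) :
    dualEquiv K n (tangentMul a b) = groupProduct (dualEquiv K n a) (dualEquiv K n b) := by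
  refine Units.ext ?_
  rw [groupProduct, Units.val_mul, Units.val_mul, val_inv_dualEquiv, val_dualEquiv, val_dualEquiv,
    dualMatrix_mul, dualMatrix_mul]
  congr 1
  simp only [tangentMul, mul_neg, neg_mul, add_mul, mul_assoc]
  abel

variable [TopologicalSpace K] [IsTopologicalRing K]

theorem isSymmetricSpaceIso_dualEquiv :
    IsSymmetricSpaceIso K (unitsBundleChart (Matrix (Fin n) (Fin n) K))
      (Units.val : GLn n (DualNumber K) → _) tangentMul groupProduct (dualEquiv K n) where
  smooth := by
    let A : Matrix (Fin n) (Fin n) K × Matrix (Fin n) (Fin n) K →L[K]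
        Matrix (Fin n) (Fin n) (DualNumber K) :=
      matrixMapCLM n (TrivSqZeroExt.inlCLM K K).toLinearMap (TrivSqZeroExt.inlCLM K K).cont ∘L
        ContinuousLinearMap.fst K _ _ +
      matrixMapCLM n (TrivSqZeroExt.inrCLM K K).toLinearMap (TrivSqZeroExt.inrCLM K K).cont ∘L
        ContinuousLinearMap.snd K _ _
    exact (HasSmoothDifferential.continuousLinearMap _ A).smoothMap
      (Units.val_injective.prodMap Function.injective_id) (fun a => rfl)
  smooth_symm := by
    let A : Matrix (Fin n) (Fin n) (DualNumber K) →L[K]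
        Matrix (Fin n) (Fin n) K × Matrix (Fin n) (Fin n) K :=
      (matrixMapCLM n (TrivSqZeroExt.fstCLM K K).toLinearMap (TrivSqZeroExt.fstCLM K K).cont).prod
      (matrixMapCLM n (TrivSqZeroExt.sndCLM K K).toLinearMap (TrivSqZeroExt.sndCLM K K).cont)
    exact (HasSmoothDifferential.continuousLinearMap _ A).smoothMap
      Units.val_injective (fun a => rfl)
  map_mul := dualEquiv_tangentMul

end DualNumbers

/-! ### The symmetric pair of the homogeneous space. -/

section SymmetricPair

variable {K : Type u} [CommRing K] [TopologicalSpace K] [IsTopologicalRing K] [Invertible (2 : K)]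

theorem isSymmetricPair_glDual (hK : HasContinuousInverse K) (n : ℕ) :
    IsSymmetricPair K (glChart n (DegenerateQuaternion K)) (glInvolution K n) (glDual K n) where
  chart := ((matrixQuatCoordinates n).hasContinuousInverse (hK.matrix n)).isGlobalChart
  smooth_mul := ((matrixQuatCoordinates n).hasContinuousInverse (hK.matrix n)).smoothMap_mul
  smooth_inv := ((matrixQuatCoordinates n).hasContinuousInverse (hK.matrix n)).smoothMap_inv
  smooth_invol := by
    have hc : Continuous (quatInvolution K) := Continuous.subtype_mk
      ((continuous_const.mul continuous_subtype_val).mul continuous_const) _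
    exact (HasSmoothDifferential.continuousLinearMap _
      (matrixMapCLM n (quatInvolution K).toLinearMap hc)).smoothMap Units.val_injective
      (fun a => rfl)
  invol := glInvolution_glInvolution n
  mem_iff := mem_glDual_iff n

end SymmetricPair

end SymBundle

open SymBundle
theorem theorem6p2 {K : Type*} [CommRing K] [Nontrivial K] [TopologicalSpace K]
    [IsTopologicalRing K] [T2Space K] [Invertible (2 : K)]
    (hdense : Dense {x : K | IsUnit x}) (hopen : IsOpen {x : K | IsUnit x})
    (hinv : ContinuousOn (Ring.inverse : K → K) {x : K | IsUnit x})
    (n : ℕ) (hn : 0 < n) :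
    -- the usual structure: the tangent bundle of `GL(n, K)` is `GL(n, K[ε])`, and its Lie triple
    -- representation is the adjoint one
    IsSymmetricBundle K (glChart n K) groupProduct (usualProduct K n) ∧
    (∃ j : TGL K n ≃ GLn n (DualNumber K),
      (∀ (g : GLn n K) (X : Matrix (Fin n) (Fin n) K),
        (j (g, X)).val = g.val.map TrivSqZeroExt.inl + X.map TrivSqZeroExt.inr) ∧
      IsSymmetricSpaceIso K (bundleChart (glChart n K)) (glChart n (DualNumber K))
        (usualProduct K n) groupProduct j) ∧
    IsLieTripleSystem K (ltsBracket K (glChart n K) groupProduct 1) ∧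
    bundleR K (glChart n K) (usualProduct K n) 1
      = adjointR (ltsBracket K (glChart n K) groupProduct 1) ∧
    bundleM K (glChart n K) (usualProduct K n) 1
      = adjointM (ltsBracket K (glChart n K) groupProduct 1) ∧
    -- the group `GL(n, D)` with its involution and the subgroup `GL(n, K[ε])`
    IsSymmetricPair K (glChart n (DegenerateQuaternion K)) (glInvolution K n) (glDual K n) ∧
    -- the second structure
    ∃ μ : TGL K n → TGL K n → TGL K n,
      IsSymmetricBundle K (glChart n K) groupProduct μ ∧
      (∃ Φ : GLn n (DegenerateQuaternion K) ⧸ glDual K n ≃ TGL K n,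
        IsHomogeneousRealization K (glChart n (DegenerateQuaternion K)) (glInvolution K n)
          (glDual K n) (bundleChart (glChart n K)) μ Φ ∧
        -- the underlying homogeneous bundle is the usual one
        Φ ((1 : GLn n (DegenerateQuaternion K)) :
          GLn n (DegenerateQuaternion K) ⧸ glDual K n) = (1, 0) ∧
        ∀ (g h : GLn n K) (x : GLn n (DegenerateQuaternion K) ⧸ glDual K n),
          Φ (glPair K n g h • x) = (g * (Φ x).1 * h⁻¹, g.val * (Φ x).2 * (h⁻¹).val)) ∧
      -- so is the underlying reflection space
      verticalSymmetry K μ = verticalSymmetry K (usualProduct K n) ∧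
      -- the Lie triple representations agree in their `r`-components but are not equivalent
      IsLtsModule K (ltsBracket K (glChart n K) groupProduct 1)
        (bundleR K (glChart n K) μ 1) (bundleM K (glChart n K) μ 1) ∧
      bundleR K (glChart n K) μ 1
        = adjointR (ltsBracket K (glChart n K) groupProduct 1) ∧
      ¬ LtsModuleEquivalent K
        (bundleR K (glChart n K) μ 1) (bundleM K (glChart n K) μ 1)
        (adjointR (ltsBracket K (glChart n K) groupProduct 1))
        (adjointM (ltsBracket K (glChart n K) groupProduct 1)) ∧
      -- nor are the two symmetric bundles isomorphic
      ¬ ∃ f e, IsSymmetricBundleIso K (glChart n K) groupProduct (usualProduct K n) μ f e := by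
  have hK : HasContinuousInverse K := ⟨hopen, hinv⟩
  have hR := hK.matrix n
  -- Makes the matrix ring nontrivial, as both non-existence statements require.
  have : Nonempty (Fin n) := ⟨⟨0, hn⟩⟩
  have hu : usualProduct K n = tangentMul := hR.tangentProduct_eq hdense
  have hB : ltsBracket K (glChart n K) groupProduct 1 = tripleCommutator (⅟(2 : K) * ⅟(2 : K)) :=
    funext fun x => funext fun y => funext fun z => hR.ltsBracket_eq hdense x y z
  have hr : bundleR K (glChart n K) twistedMul 1 = tripleCommutator (⅟(2 : K) * ⅟(2 : K)) :=
    funext fun x => funext fun y => funext fun z => hR.bundleR_twistedMul hdense x y z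
  have hm : bundleM K (glChart n K) twistedMul 1 = tripleAnticommutator (⅟(2 : K) * ⅟(2 : K)) :=
    funext fun x => funext fun y => funext fun z => hR.bundleM_twistedMul hdense x y z
  rw [hu, hB]
  refine ⟨hR.isSymmetricBundle_tangentMul hdense,
    ⟨dualEquiv K n, fun g X => rfl, isSymmetricSpaceIso_dualEquiv⟩,
    isLieTripleSystem_tripleCommutator _,
    funext fun x => funext fun y => funext fun z => hR.bundleR_tangentMul hdense x y z,
    funext fun x => funext fun y => funext fun z => hR.bundleM_tangentMul hdense x y z,
    isSymmetricPair_glDual hK n, twistedMul, hR.isSymmetricBundle_twistedMul hdense,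
    ⟨(isSwap_glInvolution n).quotientEquiv (mem_glDual_iff n),
      (isSwap_glInvolution n).isHomogeneousRealization (mem_glDual_iff n) hR,
      (matrixQuatCoordinates n).toBundle_one, ?_⟩, ?_, ?_, ?_, ?_, not_isSymmetricBundleIso hdense⟩
  · rintro g h ⟨x⟩
    obtain ⟨hP, hX, hY, hQ⟩ := glPair_coords n g h
    have key := (matrixQuatCoordinates n).toBundle_diagonal_mul hX hY x
    rw [hP, hQ] at key
    exact key
  · funext a b
    rw [verticalSymmetry_tangentMul, verticalSymmetry_twistedMul]
  · rw [hr, hm]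
    exact isLtsModule_tripleAnticommutator _
  · rw [hr]
    rfl
  · rw [hr, hm]
    exact not_ltsModuleEquivalent
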